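/- **Lemma.** Let $n\ge 1$, and let $K\subset\mathbb R^{n+1}$ be a smooth, strictly convex body (a compact convex set with non-empty interior whose boundary is a $C^\infty$ hypersurface with positive definite second fundamental form) containing the origin in its interior. Let $h(x)=\max_{y\in K}\langle x,y\rangle$, $x\in\mathbb S^n$, be its support function, let $\theta$ be the spherical Lebesgue measure on $\mathbb S^n$, and let $\bar g$ and $\bar\nabla$ be the round metric of $\mathbb S^n$ and its Levi-Civita connection. Let $\mathcal K$ be the Gauss curvature, as a function of the outer unit normal, so that $1/\mathcal K=\det(\bar\nabla^2h+h\bar g)/\det\bar g$. Put $$dV=\frac{h}{\mathcal K}\,d\theta,\qquad X(x)=\bar\nabla h(x)+h(x)x,\qquad c=c(K)=\frac{\int_{\mathbb S^n} X\,dV}{\int_{\mathbb S^n} dV},$$ and let $\tilde h(x)=h(x)-\langle x,c\rangle$ be the support function of $K-c$. If $dV=h^p\,d\theta$ for some real number $p>-n-1$, then $$\int_{\mathbb S^n}|\bar\nabla h|^2\,dV=\int_{\mathbb S^n}|\bar\nabla\tilde h|^2\,dV+\frac{n(n+1-p)\,|c|^2}{(n+1)(n+1+p)}\int_{\mathbb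 S^n}dV .$$ -/

import Mathlib

open MeasureTheory Metric
open scoped RealInnerProductSpace ContDiff

noncomputable section

/-- The Euclidean space of dimension `n + 1`. -/
abbrev Euc (n : ℕ) : Type := EuclideanSpace ℝ (Fin (n + 1))

/-- The unit sphere of dimension `n` in `Euc n`. -/
abbrev Sph (n : ℕ) : Type := sphere (0 : Euc n) 1

/-- Spherical Lebesgue measure (surface measure) on the unit sphere. -/
def sphMeasure (n : ℕ) : Measure (Sph n) := (volume : Measure (Euc n)).toSphere

/-- A compact convex set with non-empty interior, whose boundary is a smooth hypersurface with
everywhere positive definite second fundamental form: near each boundary point `q` the set is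
`{ρ ≤ 0}` for a smooth function `ρ` with `Dρ(q) ≠ 0`, and `D²ρ(q)` is positive definite on the
tangent space `ker Dρ(q)` of the boundary at `q`. -/
structure IsSmoothStrictlyConvexBody {n : ℕ} (K : Set (Euc n)) : Prop where
  isCompact : IsCompact K
  convex : Convex ℝ K
  interior_nonempty : (interior K).Nonempty
  boundary : ∀ q ∈ frontier K, ∃ (U : Set (Euc n)) (ρ : Euc n → ℝ),
    IsOpen U ∧ q ∈ U ∧ ContDiffOn ℝ ∞ ρ U ∧ K ∩ U = {y | y ∈ U ∧ ρ y ≤ 0} ∧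
    fderiv ℝ ρ q ≠ 0 ∧
    ∀ v : Euc n, v ≠ 0 → fderiv ℝ ρ q v = 0 → 0 < fderiv ℝ (fderiv ℝ ρ) q v v

/-- The support function `h_K(x) = max {⟨x, y⟩ : y ∈ K}`. -/
def supportFun {n : ℕ} (K : Set (Euc n)) (x : Euc n) : ℝ :=
  sSup ((fun y => ⟪x, y⟫) '' K)

/-- The extension of `f` from the unit sphere to the punctured space that is constant on rays;
it depends on the values of `f` on the sphere only (the value at the origin is irrelevant). -/
def radialExt {n : ℕ} (f : Euc n → ℝ) (y : Euc n) : ℝ := f (‖y‖⁻¹ • y)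

/-- The gradient, for the round metric, of the restriction of `f` to the unit sphere, as a vector
of the ambient space: the Euclidean gradient of the extension that is constant on rays. -/
def sphGrad {n : ℕ} (f : Euc n → ℝ) (x : Euc n) : Euc n := gradient (radialExt f) x

/-- The Hessian, for the round metric, of the restriction of `f` to the unit sphere, as an
endomorphism of the tangent space at `x`, which is the orthogonal complement of `x`. It is the
covariant derivative of the gradient field: differentiate in the ambient space, then project
orthogonally to the tangent space. -/
def sphHess {n : ℕ} (f : Euc n → ℝ) (x : Euc n) :
    ((ℝ ∙ x)ᗮ : Submodule ℝ (Euc n)) →L[ℝ] ((ℝ ∙ x)ᗮ : Submodule ℝ (Euc n)) :=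
  ((ℝ ∙ x)ᗮ).orthogonalProjectionOnto ∘L fderiv ℝ (sphGrad f) x ∘L ((ℝ ∙ x)ᗮ).subtypeL

/-- The Gauss curvature of `K` as a function of the outward unit normal `x`; its inverse is the
determinant of `∇²h + h g` relative to `g`, where `g` is the round metric. -/
def gaussCurv {n : ℕ} (K : Set (Euc n)) (x : Euc n) : ℝ :=
  (LinearMap.det (sphHess (supportFun K) x +
    supportFun K x • ContinuousLinearMap.id ℝ ((ℝ ∙ x)ᗮ : Submodule ℝ (Euc n)) :
      ((ℝ ∙ x)ᗮ : Submodule ℝ (Euc n)) →ₗ[ℝ] ((ℝ ∙ x)ᗮ : Submodule ℝ (Euc n))))⁻¹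

/-- The measure `V_K` with `dV_K = (h_K / 𝒦_K) dθ`, which is `n + 1` times the cone-volume
measure. -/
def coneMeasure {n : ℕ} (K : Set (Euc n)) : Measure (Sph n) :=
  (sphMeasure n).withDensity
    (fun x => ENNReal.ofReal (supportFun K (x : Euc n) / gaussCurv K (x : Euc n)))

/-- The inverse Gauss map `X = Dh = ∇h + h x`. -/
def invGaussMap {n : ℕ} (K : Set (Euc n)) (x : Euc n) : Euc n :=
  sphGrad (supportFun K) x + supportFun K x • x

/-- The point `c(K) = ∫ X dV / ∫ dV`. -/
def coneCenter {n : ℕ} (K : Set (Euc n)) : Euc n :=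
  (∫ _x : Sph n, (1 : ℝ) ∂(coneMeasure K))⁻¹ •
    ∫ x : Sph n, invGaussMap K (x : Euc n) ∂(coneMeasure K)

/-- The translated body `K - c(K)`. -/
def centeredBody {n : ℕ} (K : Set (Euc n)) : Set (Euc n) :=
  (fun y => y - coneCenter K) '' K

end

/-!
Integrating by parts in polar coordinates adapted to a gauge `γ` gives, for a function `F`
homogeneous of degree `d` and a vector `e`, the identity `∫ DF·e = (n + d) ∫ F Dγ·e` over the
hypersurface `γ = 1`. It is used for two gauges. With `γ` the Euclidean norm it concerns the sphere
with `θ`. With `γ` the gauge of `K` it concerns the boundary of `K`, parametrized by `X = Dh`, for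
which `dV` is the radial measure, because the map `r x ↦ r X(x)` has Jacobian determinant `h / 𝒦` on
the sphere; moreover `Dγ(X(x)) = x / h(x)`.

Write `V` for the total mass of `dV = h ^ p dθ`. On the sphere, `F = h ^ (p + 1)` and
`F = h ^ p ⟪·, c⟫` give
`(p + 1) ∫ ⟪X, c⟫ dV = (n + 1 + p) ∫ h ⟪x, c⟫ dV` and
`p ∫ ⟪X, c⟫ ⟪x, c⟫ / h dV + |c|² V = (n + 1 + p) ∫ ⟪x, c⟫² dV`,
and on the boundary of `K`, `F = ⟪·, c⟫` gives `(n + 1) ∫ ⟪X, c⟫ ⟪x, c⟫ / h dV = |c|² V`. Since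
`∫ ⟪X, c⟫ dV = |c|² V` by the choice of `c`, all the terms of the pointwise expansion
`|∇h|² - |∇h̃|² = 2 ⟪X, c⟫ - |c|² + ⟪x, c⟫² - 2 h ⟪x, c⟫` have known integrals.
-/

open Filter Topology

section PosHomogeneous

variable {E : Type*} [NormedAddCommGroup E] [NormedSpace ℝ E]

/-- Positive homogeneity of degree `d`. Nothing is required at the origin, where a homogeneous
function of degree `d ≤ 0` need not be defined. -/
def IsPosHomogeneous (F : E → ℝ) (d : ℝ) : Prop :=
  ∀ t : ℝ, 0 < t → ∀ y : E, y ≠ 0 → F (t • y) = t ^ d * F y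

namespace IsPosHomogeneous

variable {F G : E → ℝ} {d d' : ℝ}

theorem mul (hF : IsPosHomogeneous F d) (hG : IsPosHomogeneous G d') :
    IsPosHomogeneous (fun y => F y * G y) (d + d') := fun t ht y hy => by
  simp only [hF t ht y hy, hG t ht y hy, Real.rpow_add ht]
  ring

theorem rpow (hF : IsPosHomogeneous F d) (hF₀ : ∀ y ≠ 0, 0 ≤ F y) (s : ℝ) :
    IsPosHomogeneous (fun y => F y ^ s) (d * s) := fun t ht y hy => by
  simp only [hF t ht y hy, Real.mul_rpow (by positivity : 0 ≤ t ^ d) (hF₀ y hy),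
    Real.rpow_mul ht.le]

theorem of_map_smul (hF : ∀ t : ℝ, 0 < t → ∀ y, F (t • y) = t * F y) : IsPosHomogeneous F 1 :=
  fun t ht y _ => by rw [hF t ht y, Real.rpow_one]

theorem fderiv_smul (hF : IsPosHomogeneous F d) {t : ℝ} (ht : 0 < t) {y : E} (hy : y ≠ 0) :
    fderiv ℝ F (t • y) = t ^ (d - 1) • fderiv ℝ F y := by
  have scaled : (fun z => F (t • z)) =ᶠ[𝓝 y] fun z => t ^ d • F z := by
    filter_upwards [isOpen_ne.mem_nhds hy] with z hz using hF t ht z hz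
  have chain := fderiv_comp_smul (f := F) (x := y) t
  have const_smul : fderiv ℝ (fun z => t ^ d • F z) y = t ^ d • fderiv ℝ F y :=
    congrFun (fderiv_const_smul_field (f := F) (t ^ d)) y
  rw [scaled.fderiv_eq, const_smul] at chain
  rw [Real.rpow_sub_one ht.ne', div_eq_inv_mul, mul_smul, chain, inv_smul_smul₀ ht.ne']

end IsPosHomogeneous

end PosHomogeneous

section IntegrationByParts

theorem continuous_mul_of_continuousAt_tsupport {Y : Type*} [TopologicalSpace Y] {f g : Y → ℝ}
    (hf : Continuous f) (hg : ∀ y ∈ tsupport f, ContinuousAt g y) :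
    Continuous fun y => f y * g y :=
  continuous_of_tsupport fun y hy =>
    hf.continuousAt.mul (hg y (tsupport_mul_subset_left hy))

variable {E : Type*} [NormedAddCommGroup E] [NormedSpace ℝ E] {f F : E → ℝ}

theorem continuous_mul_fderiv (hf : Continuous f) (hF : ∀ z ∈ tsupport f, ContDiffAt ℝ 1 F z)
    (e : E) : Continuous fun z => f z * fderiv ℝ F z e :=
  continuous_mul_of_continuousAt_tsupport hf fun z hz =>
    ((hF z hz).fderiv_right (m := 0) le_rfl).continuousAt.clm_apply continuousAt_const

theorem continuous_fderiv_mul (hf : ContDiff ℝ 1 f) (hF : ∀ z ∈ tsupport f, ContDiffAt ℝ 1 F z)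
    (e : E) : Continuous fun z => fderiv ℝ f z e * F z :=
  continuous_mul_of_continuousAt_tsupport
    ((hf.continuous_fderiv one_ne_zero).clm_apply continuous_const) fun z hz =>
      (hF z (tsupport_fderiv_apply_subset ℝ e hz)).continuousAt

theorem integral_mul_fderiv_eq_neg_of_hasCompactSupport [MeasurableSpace E] [BorelSpace E]
    [FiniteDimensional ℝ E] {μ : Measure E} [μ.IsAddHaarMeasure] (hf : ContDiff ℝ 1 f)
    (hcomp : HasCompactSupport f) (hF : ∀ z ∈ tsupport f, ContDiffAt ℝ 1 F z) (e : E) :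
    ∫ z, f z * fderiv ℝ F z e ∂μ = -∫ z, fderiv ℝ f z e * F z ∂μ :=
  integral_mul_fderiv_eq_neg_fderiv_mul_of_integrable
    ((continuous_fderiv_mul hf hF e).integrable_of_hasCompactSupport
      (HasCompactSupport.mul_right (hcomp.fderiv_apply ℝ e)))
    ((continuous_mul_fderiv hf.continuous hF e).integrable_of_hasCompactSupport hcomp.mul_right)
    ((continuous_mul_of_continuousAt_tsupport hf.continuous fun z hz =>
      (hF z hz).continuousAt).integrable_of_hasCompactSupport hcomp.mul_right)
    (fun z _ => hf.differentiable one_ne_zero z)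
    fun z hz => (hF z hz).differentiableAt one_ne_zero

end IntegrationByParts

section RadialIntegrals

theorem integral_volumeIoiPow (n : ℕ) (φ : ℝ → ℝ) :
    ∫ r : Set.Ioi (0 : ℝ), φ r ∂(Measure.volumeIoiPow n) =
      ∫ r in Set.Ioi (0 : ℝ), r ^ n * φ r := by
  simp only [Measure.volumeIoiPow, ENNReal.ofReal]
  rw [integral_withDensity_eq_integral_smul,
    integral_subtype_comap measurableSet_Ioi fun a => Real.toNNReal (a ^ n) • φ a,
    setIntegral_congr_fun measurableSet_Ioi fun x hx => ?_]
  · rw [NNReal.smul_def, Real.coe_toNNReal _ (pow_nonneg hx.out.le _), smul_eq_mul]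
  · exact (measurable_subtype_coe.pow_const _).real_toNNReal

variable {ψ : ℝ → ℝ}

theorem continuous_mul_rpow_of_tsupport_subset_Ioi (hψ : Continuous ψ)
    (hpos : tsupport ψ ⊆ Set.Ioi 0) (s : ℝ) : Continuous fun r => ψ r * r ^ s :=
  continuous_mul_of_continuousAt_tsupport hψ fun r hr =>
    Real.continuousAt_rpow_const r s (Or.inl (ne_of_gt (hpos hr)))

theorem integral_deriv_mul_rpow (hψ : ContDiff ℝ 1 ψ) (hcomp : HasCompactSupport ψ)
    (hpos : tsupport ψ ⊆ Set.Ioi 0) (s : ℝ) :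
    ∫ r : ℝ, deriv ψ r * r ^ s = -(s * ∫ r : ℝ, ψ r * r ^ (s - 1)) := by
  have hpow (r : ℝ) (hr : r ∈ tsupport ψ) :
      HasDerivAt (fun r : ℝ => r ^ s) (s * r ^ (s - 1)) r :=
    Real.hasDerivAt_rpow_const (Or.inl (ne_of_gt (hpos hr)))
  have hψ' : Continuous (deriv ψ) := hψ.continuous_deriv le_rfl
  have hint : Integrable fun r => ψ r * r ^ s :=
    (continuous_mul_rpow_of_tsupport_subset_Ioi hψ.continuous hpos
      s).integrable_of_hasCompactSupport hcomp.mul_right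
  have hint₁ : Integrable fun r => ψ r * r ^ (s - 1) :=
    (continuous_mul_rpow_of_tsupport_subset_Ioi hψ.continuous hpos
      (s - 1)).integrable_of_hasCompactSupport hcomp.mul_right
  have hint' : Integrable fun r => deriv ψ r * r ^ s :=
    (continuous_mul_rpow_of_tsupport_subset_Ioi hψ' (tsupport_deriv_subset.trans hpos)
      s).integrable_of_hasCompactSupport hcomp.deriv.mul_right
  have hmove (r : ℝ) : ψ r * (s * r ^ (s - 1)) = s * (ψ r * r ^ (s - 1)) := by ring
  have parts := integral_mul_deriv_eq_deriv_mul_of_integrable (u := ψ) (v := fun r => r ^ s)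
    (fun r _ => (hψ.differentiable one_ne_zero r).hasDerivAt) hpow
    ((hint₁.const_mul s).congr (.of_forall fun r => (hmove r).symm)) hint' hint
  simp only [hmove, integral_const_mul] at parts
  linarith

theorem setIntegral_pow_mul_rpow (hpos : tsupport ψ ⊆ Set.Ioi 0) (n : ℕ) (s : ℝ) :
    ∫ r in Set.Ioi (0 : ℝ), r ^ n * (ψ r * r ^ s) = ∫ r, ψ r * r ^ (n + s) := by
  have hzero (r : ℝ) (hr : r ∉ Set.Ioi (0 : ℝ)) : ψ r * r ^ (n + s) = 0 := by
    rw [image_eq_zero_of_notMem_tsupport fun h => hr (hpos h), zero_mul]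
  rw [← setIntegral_eq_integral_of_forall_compl_eq_zero hzero]
  refine setIntegral_congr_fun measurableSet_Ioi fun r hr => ?_
  simp only [Real.rpow_add (Set.mem_Ioi.1 hr), Real.rpow_natCast]
  ring

end RadialIntegrals

section PolarCoordinates

variable {E α : Type*} [NormedAddCommGroup E] [NormedSpace ℝ E] [MeasurableSpace E]
  [MeasurableSpace α] {μ : Measure E} {n : ℕ} {ν : Measure α} {X : α → E} {γ : E → ℝ}

/-- Polar coordinates `z = r • X a` adapted to a radius function `γ`: the function `γ` is proper,
homogeneous of degree one and equal to `1` on the range of `X`, and `μ` is `r ^ n dr ⊗ ν` in the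
coordinates `(a, r)`. The radius function is required to be differentiable off the origin only. -/
structure PolarCoordinates (μ : Measure E) (n : ℕ) (ν : Measure α) (X : α → E) (γ : E → ℝ) :
    Prop where
  continuous : Continuous γ
  contDiffAt : ∀ z ≠ 0, ContDiffAt ℝ 1 γ z
  map_smul : ∀ t : ℝ, 0 < t → ∀ z, γ (t • z) = t * γ z
  tendsto_cocompact : Tendsto γ (cocompact E) atTop
  apply_eq_one : ∀ a, γ (X a) = 1
  measurePreserving : MeasurePreserving (fun z : α × Set.Ioi (0 : ℝ) => (z.2 : ℝ) • X z.1)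
    (ν.prod (Measure.volumeIoiPow n)) μ

namespace PolarCoordinates

theorem map_zero (h : PolarCoordinates μ n ν X γ) : γ 0 = 0 := by
  have := h.map_smul 2 two_pos 0
  rw [smul_zero] at this
  linarith

theorem ne_zero (h : PolarCoordinates μ n ν X γ) (a : α) : X a ≠ 0 := by
  intro ha
  have := h.apply_eq_one a
  rw [ha, h.map_zero] at this
  exact zero_ne_one this

theorem integral_eq_mul [SFinite ν] (h : PolarCoordinates μ n ν X γ) {G : E → ℝ} {A : ℝ → ℝ}
    {B : α → ℝ} (hG : AEStronglyMeasurable G μ)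
    (hsep : ∀ r : ℝ, 0 < r → ∀ a, G (r • X a) = A r * B a) :
    ∫ z, G z ∂μ = (∫ r in Set.Ioi (0 : ℝ), r ^ n * A r) * ∫ a, B a ∂ν := by
  rw [← h.measurePreserving.map_eq] at hG ⊢
  rw [integral_map h.measurePreserving.measurable.aemeasurable hG]
  simp only [fun z : α × Set.Ioi (0 : ℝ) => hsep z.2 z.2.2 z.1]
  have hfubini := integral_prod_mul (μ := ν) (ν := Measure.volumeIoiPow n) B
    fun r : Set.Ioi (0 : ℝ) => A r
  simp only [mul_comm (A _)]
  rw [hfubini, integral_volumeIoiPow, mul_comm]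

section Cutoff

variable {ψ : ℝ → ℝ}

theorem zero_notMem_tsupport_comp (h : PolarCoordinates μ n ν X γ)
    (hpos : tsupport ψ ⊆ Set.Ioi 0) : (0 : E) ∉ tsupport (ψ ∘ γ) := fun h₀ => by
  have := hpos (tsupport_comp_subset_preimage ψ h.continuous h₀)
  rw [h.map_zero] at this
  exact lt_irrefl _ (Set.mem_Ioi.1 this)

theorem hasCompactSupport_comp (h : PolarCoordinates μ n ν X γ) (hcomp : HasCompactSupport ψ) :
    HasCompactSupport (ψ ∘ γ) := by
  obtain ⟨R, hR⟩ := hcomp.isCompact.bddAbove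
  obtain ⟨C, hC, hCR⟩ := mem_cocompact.1 (h.tendsto_cocompact.eventually_gt_atTop R)
  exact HasCompactSupport.intro hC fun z hz =>
    image_eq_zero_of_notMem_tsupport (f := ψ) fun hγ => not_lt.2 (hR hγ) (hCR hz)

theorem contDiff_comp (h : PolarCoordinates μ n ν X γ) (hψ : ContDiff ℝ 1 ψ)
    (hpos : tsupport ψ ⊆ Set.Ioi 0) : ContDiff ℝ 1 (ψ ∘ γ) := by
  refine contDiff_iff_contDiffAt.2 fun z => ?_
  by_cases hz : z = 0
  · subst hz
    exact contDiffAt_const.congr_of_eventuallyEq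
      (notMem_tsupport_iff_eventuallyEq.1 (h.zero_notMem_tsupport_comp hpos))
  · exact hψ.contDiffAt.comp z (h.contDiffAt z hz)

end Cutoff

variable [BorelSpace E] [FiniteDimensional ℝ E] [μ.IsAddHaarMeasure] [SFinite ν]

theorem integral_cutoff (h : PolarCoordinates μ n ν X γ) {F : E → ℝ} {d : ℝ}
    (hF : ∀ z ≠ 0, ContDiffAt ℝ 1 F z) (hhom : IsPosHomogeneous F d) (e : E) {ψ : ℝ → ℝ}
    (hψ : ContDiff ℝ 1 ψ) (hcomp : HasCompactSupport ψ) (hpos : tsupport ψ ⊆ Set.Ioi 0) :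
    (∫ r in Set.Ioi (0 : ℝ), r ^ n * (ψ r * r ^ (d - 1))) * ∫ a, fderiv ℝ F (X a) e ∂ν =
      -((∫ r in Set.Ioi (0 : ℝ), r ^ n * (deriv ψ r * r ^ d)) *
        ∫ a, F (X a) * fderiv ℝ γ (X a) e ∂ν) := by
  have hf : ContDiff ℝ 1 (ψ ∘ γ) := h.contDiff_comp hψ hpos
  have hfcomp : HasCompactSupport (ψ ∘ γ) := h.hasCompactSupport_comp hcomp
  have hF' (z : E) (hz : z ∈ tsupport (ψ ∘ γ)) : ContDiffAt ℝ 1 F z :=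
    hF z fun hz₀ => h.zero_notMem_tsupport_comp hpos (hz₀ ▸ hz)
  have hray (r : ℝ) (hr : 0 < r) (a : α) : γ (r • X a) = r := by
    rw [h.map_smul r hr, h.apply_eq_one, mul_one]
  have hγ' (r : ℝ) (hr : 0 < r) (a : α) :
      fderiv ℝ (ψ ∘ γ) (r • X a) e = deriv ψ r * fderiv ℝ γ (X a) e := by
    have hrX : r • X a ≠ 0 := smul_ne_zero hr.ne' (h.ne_zero a)
    have hγhom := (IsPosHomogeneous.of_map_smul h.map_smul).fderiv_smul hr (h.ne_zero a)
    rw [sub_self, Real.rpow_zero, one_smul] at hγhom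
    rw [((hψ.differentiable one_ne_zero _).hasDerivAt.comp_hasFDerivAt _
      ((h.contDiffAt _ hrX).differentiableAt one_ne_zero).hasFDerivAt).fderiv, hray r hr, hγhom]
    rfl
  have parts := integral_mul_fderiv_eq_neg_of_hasCompactSupport (μ := μ) hf hfcomp hF' e
  rwa [h.integral_eq_mul (continuous_mul_fderiv hf.continuous hF' e).aestronglyMeasurable
      (A := fun r => ψ r * r ^ (d - 1)) (B := fun a => fderiv ℝ F (X a) e) fun r hr a => ?_,
    h.integral_eq_mul (continuous_fderiv_mul hf hF' e).aestronglyMeasurable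
      (A := fun r => deriv ψ r * r ^ d)
      (B := fun a => F (X a) * fderiv ℝ γ (X a) e) fun r hr a => ?_] at parts
  · rw [hγ' r hr, hhom r hr _ (h.ne_zero a)]
    ring
  · rw [Function.comp_apply, hray r hr, hhom.fderiv_smul hr (h.ne_zero a), smul_apply, smul_eq_mul,
      mul_assoc]

/-- The divergence theorem for the region `γ < 1`, in which `F • e` is the vector field. -/
theorem integral_fderiv_eq (h : PolarCoordinates μ n ν X γ) {F : E → ℝ} {d : ℝ}
    (hF : ∀ z ≠ 0, ContDiffAt ℝ 1 F z) (hhom : IsPosHomogeneous F d) (e : E) :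
    ∫ a, fderiv ℝ F (X a) e ∂ν = (n + d) * ∫ a, F (X a) * fderiv ℝ γ (X a) e ∂ν := by
  let ψ : ContDiffBump (2 : ℝ) := ⟨1 / 2, 1, by norm_num, by norm_num⟩
  have hpos : tsupport ψ ⊆ Set.Ioi (0 : ℝ) := fun r hr => by
    rw [ψ.tsupport_eq, Real.closedBall_eq_Icc] at hr
    have : (2 : ℝ) - 1 ≤ r := hr.1
    exact Set.mem_Ioi.2 (by linarith)
  have hcut := h.integral_cutoff hF hhom e ψ.contDiff ψ.hasCompactSupport hpos
  have hmass : 0 < ∫ r, ψ r * r ^ (n + d - 1) :=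
    (continuous_mul_rpow_of_tsupport_subset_Ioi ψ.continuous hpos
      _).integral_pos_of_hasCompactSupport_nonneg_nonzero (x := 2) ψ.hasCompactSupport.mul_right
      (fun r => ?_) ?_
  · rw [setIntegral_pow_mul_rpow hpos, setIntegral_pow_mul_rpow (tsupport_deriv_subset.trans hpos),
      integral_deriv_mul_rpow ψ.contDiff ψ.hasCompactSupport hpos, ← add_sub_assoc] at hcut
    exact mul_left_cancel₀ hmass.ne' (by linear_combination hcut)
  · by_cases hr : 0 < r
    · exact mul_nonneg ψ.nonneg (Real.rpow_nonneg hr.le _)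
    · rw [image_eq_zero_of_notMem_tsupport (f := ψ) fun h' => hr (hpos h'), zero_mul]; rfl
  · exact mul_ne_zero (ψ.pos_of_mem_ball (mem_ball_self ψ.rOut_pos)).ne'
      (Real.rpow_pos_of_pos two_pos _).ne'

end PolarCoordinates

end PolarCoordinates

theorem continuous_comp_coe_sphere {E α : Type*} [NormedAddCommGroup E] [NormedSpace ℝ E]
    [TopologicalSpace α] {f : E → α} (hf : ∀ y ≠ 0, ContinuousAt f y) :
    Continuous fun x : sphere (0 : E) 1 => f x :=
  continuous_iff_continuousAt.2 fun x =>
    (hf x (ne_zero_of_mem_unit_sphere x)).comp (f := Subtype.val) continuousAt_subtype_val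

section Norm

variable {E : Type*} [NormedAddCommGroup E] [InnerProductSpace ℝ E]

theorem hasFDerivAt_norm_of_ne_zero {y : E} (hy : y ≠ 0) :
    HasFDerivAt (fun z : E => ‖z‖) (‖y‖⁻¹ • innerSL ℝ y) y := by
  have hsqrt := (hasStrictFDerivAt_norm_sq y).hasFDerivAt.sqrt
    (pow_ne_zero 2 (norm_ne_zero_iff.2 hy))
  simp only [Real.sqrt_sq (norm_nonneg _)] at hsqrt
  refine hsqrt.congr_fderiv ?_
  rw [← Nat.cast_smul_eq_nsmul ℝ, smul_smul]
  congr 1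
  field_simp
  norm_num

variable [FiniteDimensional ℝ E] [Nontrivial E] [MeasurableSpace E] [BorelSpace E]

theorem polarCoordinates_norm (μ : Measure E) [μ.IsAddHaarMeasure] :
    PolarCoordinates μ (Module.finrank ℝ E - 1) μ.toSphere ((↑) : sphere (0 : E) 1 → E)
      fun z => ‖z‖ where
  continuous := continuous_norm
  contDiffAt z hz := contDiffAt_norm ℝ hz
  map_smul t ht z := by rw [norm_smul, Real.norm_of_nonneg ht.le]
  tendsto_cocompact := tendsto_norm_cocompact_atTop
  apply_eq_one x := norm_eq_of_mem_sphere x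
  measurePreserving := by
    have hval : MeasurePreserving (Subtype.val : ({0}ᶜ : Set E) → E) (μ.comap Subtype.val) μ := by
      have := measurePreserving_subtype_coe (μa := μ) (measurableSet_singleton (0 : E)).compl
      rwa [Measure.restrict_eq_self_of_ae_mem (s := {0}ᶜ)
        (compl_mem_ae_iff.2 (measure_singleton 0))] at this
    exact hval.comp (μ.measurePreserving_homeomorphUnitSphereProd.symm
      (homeomorphUnitSphereProd E).toMeasurableEquiv)

end Norm

section Sphere

variable {n : ℕ}

instance : IsFiniteMeasure (sphMeasure n) := by unfold sphMeasure; infer_instance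

theorem polarCoordinates_sphMeasure (n : ℕ) :
    PolarCoordinates (volume : Measure (Euc n)) n (sphMeasure n) (↑) fun z => ‖z‖ := by
  have h := polarCoordinates_norm (volume : Measure (Euc n))
  rwa [finrank_euclideanSpace, Fintype.card_fin, Nat.add_sub_cancel] at h

theorem fderiv_norm_apply_coe (x : Sph n) (e : Euc n) :
    fderiv ℝ (fun z : Euc n => ‖z‖) x e = ⟪(x : Euc n), e⟫ := by
  rw [(hasFDerivAt_norm_of_ne_zero (ne_zero_of_mem_unit_sphere x)).fderiv, norm_eq_of_mem_sphere x]
  simp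

theorem integral_fderiv_sphMeasure {F : Euc n → ℝ} {d : ℝ} (hF : ∀ z ≠ 0, ContDiffAt ℝ 1 F z)
    (hhom : IsPosHomogeneous F d) (e : Euc n) :
    ∫ x : Sph n, fderiv ℝ F x e ∂(sphMeasure n) =
      (n + d) * ∫ x : Sph n, F x * ⟪(x : Euc n), e⟫ ∂(sphMeasure n) := by
  simpa only [fderiv_norm_apply_coe] using
    (polarCoordinates_sphMeasure n).integral_fderiv_eq hF hhom e

end Sphere

section SupportFunction

variable {n : ℕ} {K : Set (Euc n)}

theorem inner_le_supportFun (hK : IsCompact K) (x : Euc n) {k : Euc n} (hk : k ∈ K) :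
    ⟪x, k⟫ ≤ supportFun K x :=
  le_csSup (hK.image (by fun_prop)).bddAbove ⟨k, hk, rfl⟩

theorem supportFun_eq_of_forall_inner_le {x q : Euc n} (hq : q ∈ K)
    (h : ∀ k ∈ K, ⟪x, k⟫ ≤ ⟪x, q⟫) : supportFun K x = ⟪x, q⟫ :=
  IsGreatest.csSup_eq ⟨⟨q, hq, rfl⟩, Set.forall_mem_image.2 h⟩

theorem exists_supportFun_eq_inner (hK : IsCompact K) (hne : K.Nonempty) (x : Euc n) :
    ∃ q ∈ K, supportFun K x = ⟪x, q⟫ := by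
  obtain ⟨q, hq, h⟩ := hK.exists_isMaxOn hne (f := fun y => ⟪x, y⟫) (by fun_prop)
  exact ⟨q, hq, supportFun_eq_of_forall_inner_le hq fun k hk => h hk⟩

theorem exists_pos_add_smul_mem {E : Type*} [NormedAddCommGroup E] [NormedSpace ℝ E] {K : Set E}
    {q : E} (hq : q ∈ interior K) (x : E) : ∃ ε : ℝ, 0 < ε ∧ q + ε • x ∈ K := by
  have hlim : Tendsto (fun ε : ℝ => q + ε • x) (𝓝[>] 0) (𝓝 q) := by
    have : ContinuousAt (fun ε : ℝ => q + ε • x) 0 := by fun_prop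
    simpa using this.tendsto.mono_left nhdsWithin_le_nhds
  obtain ⟨ε, hmem, hε⟩ := ((hlim.eventually (mem_interior_iff_mem_nhds.1 hq)).and
    self_mem_nhdsWithin).exists
  exact ⟨ε, hε, hmem⟩

theorem inner_lt_of_mem_interior {E : Type*} [NormedAddCommGroup E] [InnerProductSpace ℝ E]
    {K : Set E} {x k : E} {M : ℝ} (hx : x ≠ 0) (hk : k ∈ interior K) (h : ∀ y ∈ K, ⟪x, y⟫ ≤ M) :
    ⟪x, k⟫ < M := by
  obtain ⟨ε, hε, hmem⟩ := exists_pos_add_smul_mem hk x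
  have hM := h _ hmem
  rw [inner_add_right, real_inner_smul_right] at hM
  have := mul_pos hε (real_inner_self_pos.2 hx)
  linarith

theorem supportFun_pos (hK : IsCompact K) (h0 : (0 : Euc n) ∈ interior K) {x : Euc n}
    (hx : x ≠ 0) : 0 < supportFun K x := by
  simpa using inner_lt_of_mem_interior hx h0 fun y hy => inner_le_supportFun hK x hy

theorem mem_frontier_of_supportFun_eq (hK : IsCompact K) {x q : Euc n} (hx : x ≠ 0) (hq : q ∈ K)
    (h : supportFun K x = ⟪x, q⟫) : q ∈ frontier K :=
  ⟨subset_closure hq, fun hint =>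
    (inner_lt_of_mem_interior hx hint fun _ hy => inner_le_supportFun hK x hy).ne h.symm⟩

theorem supportFun_smul {t : ℝ} (ht : 0 ≤ t) (x : Euc n) :
    supportFun K (t • x) = t * supportFun K x := by
  simp only [supportFun, real_inner_smul_left, sSup_image', Real.mul_iSup_of_nonneg ht]

theorem gradient_supportFun_eq (hK : IsCompact K) {x q : Euc n} (hq : q ∈ K)
    (h : supportFun K x = ⟪x, q⟫) (hd : DifferentiableAt ℝ (supportFun K) x) :
    gradient (supportFun K) x = q := by
  have hmin : IsLocalMin (fun y => supportFun K y - ⟪q, y⟫) x := .of_forall fun y => by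
    have := inner_le_supportFun hK y hq
    rw [real_inner_comm] at this
    simp only [h, real_inner_comm, sub_self]
    linarith
  have hzero := hmin.hasFDerivAt_eq_zero (hd.hasFDerivAt.sub (innerSL ℝ q).hasFDerivAt)
  exact ext_inner_right ℝ fun v => by
    rw [inner_gradient_left, sub_eq_zero.1 hzero, innerSL_apply_apply]

end SupportFunction

section DefiningFunction

variable {E : Type*} [NormedAddCommGroup E] [NormedSpace ℝ E]

/-- A smooth function `ρ` such that `K` is `{ρ ≤ 0}` in the open set `U`. Used near a boundary point
of `K`, where it vanishes, to describe the outer normals of `K` by the gradient of `ρ`. -/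
structure IsDefiningFunctionOn (ρ : E → ℝ) (K U : Set E) : Prop where
  isOpen : IsOpen U
  contDiffOn : ContDiffOn ℝ ∞ ρ U
  inter_eq : K ∩ U = {y | y ∈ U ∧ ρ y ≤ 0}

namespace IsDefiningFunctionOn

variable {K U : Set E} {ρ : E → ℝ} {q : E}

theorem contDiffAt (h : IsDefiningFunctionOn ρ K U) (hqU : q ∈ U) : ContDiffAt ℝ ∞ ρ q :=
  h.contDiffOn.contDiffAt (h.isOpen.mem_nhds hqU)

theorem differentiableAt (h : IsDefiningFunctionOn ρ K U) (hqU : q ∈ U) :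
    DifferentiableAt ℝ ρ q :=
  (h.contDiffAt hqU).differentiableAt (by simp)

theorem mem_iff (h : IsDefiningFunctionOn ρ K U) (hqU : q ∈ U) : q ∈ K ↔ ρ q ≤ 0 := by
  simpa [hqU] using Set.ext_iff.1 h.inter_eq q

theorem eq_zero_of_mem_frontier (h : IsDefiningFunctionOn ρ K U) (hK : IsClosed K) (hqU : q ∈ U)
    (hq : q ∈ frontier K) : ρ q = 0 := by
  refine le_antisymm ((h.mem_iff hqU).1 (hK.frontier_subset hq)) (not_lt.1 fun hlt => hq.2 ?_)
  rw [mem_interior_iff_mem_nhds]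
  filter_upwards [h.isOpen.mem_nhds hqU,
    (h.contDiffAt hqU).continuousAt.eventually_lt_const hlt] with y hyU hy
  exact (h.mem_iff hyU).2 hy.le

theorem fderiv_sub_nonpos (h : IsDefiningFunctionOn ρ K U) (hK : Convex ℝ K) (hqU : q ∈ U)
    (hq : ρ q = 0) {k : E} (hk : k ∈ K) : fderiv ℝ ρ q (k - q) ≤ 0 := by
  have hmax : IsLocalMaxOn ρ K q := by
    filter_upwards [mem_nhdsWithin_of_mem_nhds (h.isOpen.mem_nhds hqU), self_mem_nhdsWithin]
      with y hyU hyK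
    exact ((h.mem_iff hyU).1 hyK).trans hq.ge
  exact hmax.hasFDerivWithinAt_nonpos (h.differentiableAt hqU).hasFDerivAt.hasFDerivWithinAt
    (sub_mem_posTangentConeAt_of_segment_subset
      (hK.segment_subset ((h.mem_iff hqU).2 hq.le) hk))

end IsDefiningFunctionOn

end DefiningFunction

section OuterNormal

variable {E : Type*} [NormedAddCommGroup E] [InnerProductSpace ℝ E] [CompleteSpace E]
  {K U : Set E} {ρ : E → ℝ} {q x : E}

theorem gradient_ne_zero_of_fderiv_ne_zero (hne : fderiv ℝ ρ q ≠ 0) : gradient ρ q ≠ 0 :=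
  (InnerProductSpace.toDual ℝ E).symm.map_ne_zero_iff.2 hne

namespace IsDefiningFunctionOn

theorem contDiffAt_gradient (h : IsDefiningFunctionOn ρ K U) (hqU : q ∈ U) :
    ContDiffAt ℝ ∞ (gradient ρ) q :=
  (InnerProductSpace.toDual ℝ E).symm.contDiff.contDiffAt.comp q
    ((h.contDiffAt hqU).fderiv_right (by simp))

theorem inner_smul_gradient_le (h : IsDefiningFunctionOn ρ K U) (hK : Convex ℝ K)
    (hqU : q ∈ U) (hq : ρ q = 0) {l : ℝ} (hl : 0 ≤ l) {k : E} (hk : k ∈ K) :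
    ⟪l • gradient ρ q, k⟫ ≤ ⟪l • gradient ρ q, q⟫ := by
  rw [← sub_nonpos, ← inner_sub_right, real_inner_smul_left, inner_gradient_left]
  exact mul_nonpos_of_nonneg_of_nonpos hl (h.fderiv_sub_nonpos hK hqU hq hk)

theorem exists_pos_smul_gradient_eq (h : IsDefiningFunctionOn ρ K U) (hK : Convex ℝ K)
    (hint : (interior K).Nonempty) (hqU : q ∈ U) (hq : ρ q = 0) (hne : fderiv ℝ ρ q ≠ 0)
    (hx : x ≠ 0) (hmax : ∀ k ∈ K, ⟪x, k⟫ ≤ ⟪x, q⟫) : ∃ l : ℝ, 0 < l ∧ x = l • gradient ρ q := by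
  have hext : IsLocalExtrOn (innerSL ℝ x) {y | ρ y = ρ q} q := by
    refine Or.inr ?_
    filter_upwards [mem_nhdsWithin_of_mem_nhds (h.isOpen.mem_nhds hqU), self_mem_nhdsWithin]
      with y hyU hy
    exact hmax y ((h.mem_iff hyU).2 (hy.trans hq).le)
  obtain ⟨a, b, hab, hlin⟩ := hext.exists_multipliers_of_hasStrictFDerivAt_1d
    ((h.contDiffAt hqU).hasStrictFDerivAt (by simp)) (innerSL ℝ x).hasStrictFDerivAt
  have hb : b ≠ 0 := by
    rintro rfl
    simp_all
  have hxeq : x = (-(b⁻¹ * a)) • gradient ρ q := ext_inner_right ℝ fun v => by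
    have hv := DFunLike.congr_fun hlin v
    simp only [add_apply, smul_apply, innerSL_apply_apply, smul_eq_mul, zero_apply] at hv
    rw [real_inner_smul_left, inner_gradient_left]
    field_simp
    linarith
  obtain ⟨k, hk⟩ := hint
  have hlt := inner_lt_of_mem_interior hx hk hmax
  have hle := h.fderiv_sub_nonpos hK hqU hq (interior_subset hk)
  refine ⟨_, ?_, hxeq⟩
  rw [← sub_neg, ← inner_sub_right, hxeq, real_inner_smul_left, inner_gradient_left] at hlt
  exact pos_of_mul_neg_left hlt hle

end IsDefiningFunctionOn

end OuterNormal

theorem exists_contDiffAt_rightInverse {E : Type*} [NormedAddCommGroup E] [NormedSpace ℝ E]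
    [FiniteDimensional ℝ E] {F : E → E} {a : E} {k : WithTop ℕ∞} (hF : ContDiffAt ℝ k F a)
    (hk : k ≠ 0) (hinj : Function.Injective (fderiv ℝ F a)) :
    ∃ Θ : E → E, ContDiffAt ℝ k Θ (F a) ∧ Θ (F a) = a ∧ ∀ᶠ w in 𝓝 (F a), F (Θ w) = w := by
  have : CompleteSpace E := FiniteDimensional.complete ℝ E
  let L : E ≃L[ℝ] E :=
    (LinearEquiv.ofInjectiveEndo (fderiv ℝ F a : E →ₗ[ℝ] E) hinj).toContinuousLinearEquiv
  have hL : HasFDerivAt F (L : E →L[ℝ] E) a := (hF.differentiableAt hk).hasFDerivAt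
  exact ⟨hF.localInverse hL hk, hF.to_localInverse hL hk, hF.localInverse_apply_image hL hk,
    (hF.hasStrictFDerivAt' hL hk).eventually_right_inverse⟩

section NormalMap

variable {E : Type*} [NormedAddCommGroup E] [InnerProductSpace ℝ E] [CompleteSpace E] {ρ : E → ℝ}
  {q : E}

/-- The map `(z, s) ↦ (s Dρ(z), ρ(z))`. Over the second coordinate `0` it sends a point `z` of the
hypersurface `{ρ = 0}` to the normal vectors at `z`, so that its local inverses recover boundary
points from their normals. -/
noncomputable def normalMap (ρ : E → ℝ) (z : E × ℝ) : E × ℝ := (z.2 • gradient ρ z.1, ρ z.1)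

theorem inner_fderiv_gradient (v w : E) :
    ⟪fderiv ℝ (gradient ρ) q v, w⟫ = fderiv ℝ (fderiv ℝ ρ) q v w := by
  have hfderiv : fderiv ℝ ρ = fun z => InnerProductSpace.toDual ℝ E (gradient ρ z) :=
    funext fun z => (LinearIsometryEquiv.apply_symm_apply _ _).symm
  rw [hfderiv]
  change _ = fderiv ℝ ((InnerProductSpace.toDual ℝ E) ∘ gradient ρ) q v w
  rw [LinearIsometryEquiv.comp_fderiv]
  exact (InnerProductSpace.toDual_apply_apply).symm

theorem injective_fderiv_normalMap (hρ : DifferentiableAt ℝ ρ q)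
    (hgrad : DifferentiableAt ℝ (gradient ρ) q) (hne : fderiv ℝ ρ q ≠ 0)
    (hpos : ∀ v : E, v ≠ 0 → fderiv ℝ ρ q v = 0 → 0 < fderiv ℝ (fderiv ℝ ρ) q v v) {m : ℝ}
    (hm : 0 < m) : Function.Injective (fderiv ℝ (normalMap ρ) (q, m)) := by
  have hfst : HasFDerivAt Prod.fst (ContinuousLinearMap.fst ℝ E ℝ) (q, m) := hasFDerivAt_fst
  have hder : HasFDerivAt (normalMap ρ)
      ((m • (fderiv ℝ (gradient ρ) q ∘L ContinuousLinearMap.fst ℝ E ℝ) +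
        (ContinuousLinearMap.snd ℝ E ℝ).smulRight (gradient ρ q)).prod
        (fderiv ℝ ρ q ∘L ContinuousLinearMap.fst ℝ E ℝ)) (q, m) :=
    (hasFDerivAt_snd.smul (HasFDerivAt.comp (f := Prod.fst) (q, m) hgrad.hasFDerivAt hfst)).prodMk
      (HasFDerivAt.comp (f := Prod.fst) (q, m) hρ.hasFDerivAt hfst)
  rw [hder.fderiv, injective_iff_map_eq_zero]
  rintro ⟨v, s⟩ hvs
  obtain ⟨hnormal, htangent⟩ : m • fderiv ℝ (gradient ρ) q v + s • gradient ρ q = 0 ∧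
      fderiv ℝ ρ q v = 0 := Prod.mk_eq_zero.1 hvs
  have hv : v = 0 := by
    by_contra hv
    have hinner := congrArg (fun u => ⟪u, v⟫) hnormal
    simp only [inner_add_left, real_inner_smul_left, inner_gradient_left, htangent,
      inner_fderiv_gradient, mul_zero, add_zero, inner_zero_left] at hinner
    exact (mul_pos hm (hpos v hv htangent)).ne' hinner
  subst hv
  have hs : s = 0 := by
    simpa [gradient_ne_zero_of_fderiv_ne_zero hne] using hnormal
  rw [hs, Prod.mk_zero_zero]

end NormalMap

theorem contDiffAt_supportFun_pos_smul_gradient {n : ℕ} {K U : Set (Euc n)} {ρ : Euc n → ℝ}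
    {q : Euc n} (h : IsDefiningFunctionOn ρ K U) (hK : Convex ℝ K) (hqU : q ∈ U) (hq : ρ q = 0)
    (hne : fderiv ℝ ρ q ≠ 0)
    (hpos : ∀ v : Euc n, v ≠ 0 → fderiv ℝ ρ q v = 0 → 0 < fderiv ℝ (fderiv ℝ ρ) q v v)
    {m : ℝ} (hm : 0 < m) : ContDiffAt ℝ ∞ (supportFun K) (m • gradient ρ q) := by
  have hgrad := h.contDiffAt_gradient hqU
  have hN : ContDiffAt ℝ ∞ (normalMap ρ) (q, m) :=
    (contDiffAt_snd.smul (hgrad.comp (q, m) (f := Prod.fst) contDiffAt_fst)).prodMk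
      ((h.contDiffAt hqU).comp (q, m) (f := Prod.fst) contDiffAt_fst)
  obtain ⟨Θ, hΘ, hΘq, hright⟩ := exists_contDiffAt_rightInverse hN (by simp)
    (injective_fderiv_normalMap (h.differentiableAt hqU) (hgrad.differentiableAt (by simp)) hne
      hpos hm)
  have hNq : normalMap ρ (q, m) = (m • gradient ρ q, 0) := by rw [normalMap, hq]
  rw [hNq] at hΘ hΘq hright
  have hincl : ContDiff ℝ ∞ fun x : Euc n => (x, (0 : ℝ)) := contDiff_id.prodMk contDiff_const
  have hZ : ContDiffAt ℝ ∞ (fun x => Θ (x, 0)) (m • gradient ρ q) :=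
    hΘ.comp (m • gradient ρ q) (f := fun x => (x, 0)) hincl.contDiffAt
  have hnear : ∀ᶠ x in 𝓝 (m • gradient ρ q), (Θ (x, 0)).1 ∈ U ∧ 0 < (Θ (x, 0)).2 := by
    have hopen : ∀ᶠ z in 𝓝 (q, m), z.1 ∈ U ∧ 0 < z.2 :=
      (continuousAt_fst.eventually (h.isOpen.mem_nhds hqU)).and
        (continuousAt_snd.eventually (lt_mem_nhds hm))
    rw [← hΘq] at hopen
    exact hZ.continuousAt.eventually hopen
  have hsupp : supportFun K =ᶠ[𝓝 (m • gradient ρ q)] fun x => ⟪x, (Θ (x, 0)).1⟫ := by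
    filter_upwards [hincl.continuous.continuousAt.eventually hright, hnear] with x hx ⟨hxU, hxpos⟩
    obtain ⟨hnormal, hzero⟩ : (Θ (x, 0)).2 • gradient ρ (Θ (x, 0)).1 = x ∧ ρ (Θ (x, 0)).1 = 0 :=
      Prod.ext_iff.1 hx
    refine supportFun_eq_of_forall_inner_le ((h.mem_iff hxU).2 hzero.le) fun k hk => ?_
    have := h.inner_smul_gradient_le hK hxU hzero hxpos.le hk
    rwa [hnormal] at this
  exact (contDiffAt_id.inner ℝ hZ.fst).congr_of_eventuallyEq hsupp

namespace IsSmoothStrictlyConvexBody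

variable {n : ℕ} {K : Set (Euc n)} {q x y : Euc n}

theorem nonempty (hK : IsSmoothStrictlyConvexBody K) : K.Nonempty :=
  hK.interior_nonempty.mono interior_subset

theorem exists_isDefiningFunctionOn (hK : IsSmoothStrictlyConvexBody K) (hq : q ∈ frontier K) :
    ∃ (U : Set (Euc n)) (ρ : Euc n → ℝ), IsDefiningFunctionOn ρ K U ∧ q ∈ U ∧ ρ q = 0 ∧
      fderiv ℝ ρ q ≠ 0 ∧
      ∀ v : Euc n, v ≠ 0 → fderiv ℝ ρ q v = 0 → 0 < fderiv ℝ (fderiv ℝ ρ) q v v := by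
  obtain ⟨U, ρ, hU, hqU, hρ, hKU, hne, hpos⟩ := hK.boundary q hq
  have h : IsDefiningFunctionOn ρ K U := ⟨hU, hρ, hKU⟩
  exact ⟨U, ρ, h, hqU, h.eq_zero_of_mem_frontier hK.isCompact.isClosed hqU hq, hne, hpos⟩

theorem contDiffAt_supportFun (hK : IsSmoothStrictlyConvexBody K) (hx : x ≠ 0) :
    ContDiffAt ℝ ∞ (supportFun K) x := by
  obtain ⟨q, hq, hqx⟩ := exists_supportFun_eq_inner hK.isCompact hK.nonempty x
  obtain ⟨U, ρ, h, hqU, hq0, hne, hpos⟩ :=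
    hK.exists_isDefiningFunctionOn (mem_frontier_of_supportFun_eq hK.isCompact hx hq hqx)
  obtain ⟨l, hl, rfl⟩ := h.exists_pos_smul_gradient_eq hK.convex hK.interior_nonempty hqU hq0 hne hx
    fun k hk => hqx ▸ inner_le_supportFun hK.isCompact x hk
  exact contDiffAt_supportFun_pos_smul_gradient h hK.convex hqU hq0 hne hpos hl

theorem differentiableAt_supportFun (hK : IsSmoothStrictlyConvexBody K) (hx : x ≠ 0) :
    DifferentiableAt ℝ (supportFun K) x :=
  (hK.contDiffAt_supportFun hx).differentiableAt (by simp)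

theorem contDiffAt_gradient (hK : IsSmoothStrictlyConvexBody K) (hx : x ≠ 0) :
    ContDiffAt ℝ ∞ (gradient (supportFun K)) x :=
  (InnerProductSpace.toDual ℝ (Euc n)).symm.contDiff.contDiffAt.comp x
    ((hK.contDiffAt_supportFun hx).fderiv_right (by simp))

theorem differentiableAt_gradient (hK : IsSmoothStrictlyConvexBody K) (hx : x ≠ 0) :
    DifferentiableAt ℝ (gradient (supportFun K)) x :=
  (hK.contDiffAt_gradient hx).differentiableAt (by simp)

theorem gradient_mem (hK : IsSmoothStrictlyConvexBody K) (hx : x ≠ 0) :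
    gradient (supportFun K) x ∈ K := by
  obtain ⟨q, hq, hqx⟩ := exists_supportFun_eq_inner hK.isCompact hK.nonempty x
  rwa [gradient_supportFun_eq hK.isCompact hq hqx (hK.differentiableAt_supportFun hx)]

theorem inner_gradient (hK : IsSmoothStrictlyConvexBody K) (hx : x ≠ 0) :
    ⟪x, gradient (supportFun K) x⟫ = supportFun K x := by
  obtain ⟨q, hq, hqx⟩ := exists_supportFun_eq_inner hK.isCompact hK.nonempty x
  rw [gradient_supportFun_eq hK.isCompact hq hqx (hK.differentiableAt_supportFun hx), hqx]

theorem gradient_mem_frontier (hK : IsSmoothStrictlyConvexBody K) (hx : x ≠ 0) :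
    gradient (supportFun K) x ∈ frontier K :=
  mem_frontier_of_supportFun_eq hK.isCompact hx (hK.gradient_mem hx) (hK.inner_gradient hx).symm

theorem inner_gradient_le (hK : IsSmoothStrictlyConvexBody K) (hx : x ≠ 0) {k : Euc n}
    (hk : k ∈ K) : ⟪x, k⟫ ≤ ⟪x, gradient (supportFun K) x⟫ :=
  (hK.inner_gradient hx).symm ▸ inner_le_supportFun hK.isCompact x hk

theorem gradient_smul (hK : IsSmoothStrictlyConvexBody K) {t : ℝ} (ht : 0 < t) (hx : x ≠ 0) :
    gradient (supportFun K) (t • x) = gradient (supportFun K) x := by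
  refine gradient_supportFun_eq hK.isCompact (hK.gradient_mem hx) ?_
    (hK.differentiableAt_supportFun (smul_ne_zero ht.ne' hx))
  rw [supportFun_smul ht.le, real_inner_smul_left, hK.inner_gradient hx]

theorem exists_pos_smul_eq_of_gradient_eq (hK : IsSmoothStrictlyConvexBody K) (hx : x ≠ 0)
    (hy : y ≠ 0) (h : gradient (supportFun K) x = gradient (supportFun K) y) :
    ∃ t : ℝ, 0 < t ∧ x = t • y := by
  obtain ⟨U, ρ, hρ, hqU, hq0, hne, -⟩ :=
    hK.exists_isDefiningFunctionOn (hK.gradient_mem_frontier hy)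
  have hnormal : ∀ z : Euc n, z ≠ 0 → gradient (supportFun K) z = gradient (supportFun K) y →
      ∃ l : ℝ, 0 < l ∧ z = l • gradient ρ (gradient (supportFun K) y) := fun z hz hzy =>
    hρ.exists_pos_smul_gradient_eq hK.convex hK.interior_nonempty hqU hq0 hne hz fun _ hk =>
      hzy ▸ hK.inner_gradient_le hz hk
  obtain ⟨a, ha, hxa⟩ := hnormal x hx h
  obtain ⟨b, hb, hyb⟩ := hnormal y hy rfl
  refine ⟨a / b, div_pos ha hb, ?_⟩
  calc
    x = (a / b) • b • gradient ρ (gradient (supportFun K) y) := by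
      rw [smul_smul, div_mul_cancel₀ a hb.ne', ← hxa]
    _ = (a / b) • y := by rw [← hyb]

theorem exists_gradient_eq (hK : IsSmoothStrictlyConvexBody K) (hq : q ∈ frontier K) :
    ∃ x : Euc n, x ≠ 0 ∧ gradient (supportFun K) x = q := by
  obtain ⟨U, ρ, h, hqU, hq0, hne, -⟩ := hK.exists_isDefiningFunctionOn hq
  have hx : gradient ρ q ≠ 0 := gradient_ne_zero_of_fderiv_ne_zero hne
  have hqK := hK.isCompact.isClosed.frontier_subset hq
  refine ⟨gradient ρ q, hx, gradient_supportFun_eq hK.isCompact hqK ?_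
    (hK.differentiableAt_supportFun hx)⟩
  refine supportFun_eq_of_forall_inner_le hqK fun k hk => ?_
  simpa using h.inner_smul_gradient_le hK.convex hqU hq0 zero_le_one hk

end IsSmoothStrictlyConvexBody

theorem inner_self_nonneg_of_hasFDerivAt {E : Type*} [NormedAddCommGroup E] [InnerProductSpace ℝ E]
    {G : E → E} {A : E →L[ℝ] E} {x : E} (h : HasFDerivAt G A x)
    (hmono : ∀ᶠ y in 𝓝 x, 0 ≤ ⟪G y - G x, y - x⟫) (v : E) : 0 ≤ ⟪A v, v⟫ := by
  have hline : HasDerivAt (fun t : ℝ => x + t • v) v 0 := by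
    simpa using ((hasDerivAt_id (0 : ℝ)).smul_const v).const_add x
  have hslope : Tendsto (fun t : ℝ => t⁻¹ * ⟪G (x + t • v) - G x, v⟫) (𝓝[>] 0) (𝓝 ⟪A v, v⟫) := by
    have hG : HasDerivAt (fun t : ℝ => G (x + t • v)) (A v) 0 :=
      HasFDerivAt.comp_hasDerivAt 0 (by simpa using h) hline
    simpa [real_inner_smul_left] using
      (hG.tendsto_slope_zero_right.inner (𝕜 := ℝ) (tendsto_const_nhds (x := v)))
  have hlim : Tendsto (fun t : ℝ => x + t • v) (𝓝[>] 0) (𝓝 x) := by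
    simpa using hline.continuousAt.tendsto.mono_left nhdsWithin_le_nhds
  refine ge_of_tendsto hslope ?_
  filter_upwards [hlim.eventually hmono, self_mem_nhdsWithin] with t ht (htpos : 0 < t)
  rw [add_sub_cancel_left, real_inner_smul_right] at ht
  exact mul_nonneg (inv_nonneg.2 htpos.le) (nonneg_of_mul_nonneg_right ht htpos)

section NormInv

variable {E : Type*} [NormedAddCommGroup E] [InnerProductSpace ℝ E]

theorem hasFDerivAt_norm_inv {y : E} (hy : y ≠ 0) :
    HasFDerivAt (fun z : E => ‖z‖⁻¹) (-(‖y‖⁻¹ ^ 3) • innerSL ℝ y) y := by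
  refine ((hasDerivAt_inv (norm_ne_zero_iff.2 hy)).comp_hasFDerivAt y
    (hasFDerivAt_norm_of_ne_zero hy)).congr_fderiv ?_
  rw [smul_smul, ← inv_pow, neg_mul, ← pow_succ]

end NormInv

/-- The map `r x ↦ r X(x)` for `r ≥ 0` and `x` in the unit sphere, where `X` is the inverse Gauss
map. It carries the unit ball to a convex body, and polar coordinates to the coordinates `(x, r)`
adapted to that body. -/
noncomputable def coneMap {n : ℕ} (K : Set (Euc n)) (y : Euc n) : Euc n :=
  ‖y‖ • gradient (supportFun K) y

/-- The Jacobian determinant of `coneMap`, which extends the density of the cone measure to a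
`0`-homogeneous function. -/
noncomputable def coneDensity {n : ℕ} (K : Set (Euc n)) (y : Euc n) : ℝ :=
  (fderiv ℝ (coneMap K) y).det

namespace IsSmoothStrictlyConvexBody

variable {n : ℕ} {K : Set (Euc n)} {x y : Euc n}

theorem hasFDerivAt_supportFun (hK : IsSmoothStrictlyConvexBody K) (hx : x ≠ 0) :
    HasFDerivAt (supportFun K) (innerSL ℝ (gradient (supportFun K) x)) x :=
  (hK.differentiableAt_supportFun hx).hasGradientAt.hasFDerivAt

theorem sphGrad_supportFun (hK : IsSmoothStrictlyConvexBody K) (hy : y ≠ 0) :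
    sphGrad (supportFun K) y =
      ‖y‖⁻¹ • gradient (supportFun K) y - (‖y‖⁻¹ ^ 3 * supportFun K y) • y := by
  have hext : radialExt (supportFun K) = fun z => ‖z‖⁻¹ * supportFun K z :=
    funext fun z => supportFun_smul (inv_nonneg.2 (norm_nonneg z)) z
  rw [sphGrad, hext]
  refine HasGradientAt.gradient (((hasFDerivAt_norm_inv hy).mul
    (hK.hasFDerivAt_supportFun hy)).congr_fderiv (ContinuousLinearMap.ext fun v => ?_))
  simp
  ring

theorem invGaussMap_eq_gradient (hK : IsSmoothStrictlyConvexBody K) (hx : ‖x‖ = 1) :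
    invGaussMap K x = gradient (supportFun K) x := by
  rw [invGaussMap, hK.sphGrad_supportFun (norm_ne_zero_iff.1 (hx ▸ one_ne_zero)), hx]
  simp

section Hessian

theorem inner_fderiv_gradient_eq_zero (hK : IsSmoothStrictlyConvexBody K) (hx : x ≠ 0)
    (v : Euc n) : ⟪x, fderiv ℝ (gradient (supportFun K)) x v⟫ = 0 := by
  have hEuler : (fun y => ⟪id y, gradient (supportFun K) y⟫) =ᶠ[𝓝 x] supportFun K := by
    filter_upwards [isOpen_ne.mem_nhds hx] with y hy
    exact hK.inner_gradient hy
  have hder := (((hasFDerivAt_id x).inner ℝ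
    (hK.differentiableAt_gradient hx).hasFDerivAt).congr_of_eventuallyEq hEuler.symm).unique
      (hK.hasFDerivAt_supportFun hx)
  simpa [fderivInnerCLM_apply, real_inner_comm] using DFunLike.congr_fun hder v

theorem inner_fderiv_gradient_self_nonneg (hK : IsSmoothStrictlyConvexBody K) (hx : x ≠ 0)
    (v : Euc n) : 0 ≤ ⟪fderiv ℝ (gradient (supportFun K)) x v, v⟫ := by
  refine inner_self_nonneg_of_hasFDerivAt (hK.differentiableAt_gradient hx).hasFDerivAt ?_ v
  filter_upwards [isOpen_ne.mem_nhds hx] with y hy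
  have hxy := hK.inner_gradient_le hx (hK.gradient_mem hy)
  have hyx := hK.inner_gradient_le hy (hK.gradient_mem hx)
  rw [real_inner_comm, inner_sub_left, inner_sub_right, inner_sub_right]
  linarith

theorem inner_fderiv_gradient_comm (hK : IsSmoothStrictlyConvexBody K) (hx : x ≠ 0)
    (v w : Euc n) : ⟪fderiv ℝ (gradient (supportFun K)) x v, w⟫ =
      ⟪v, fderiv ℝ (gradient (supportFun K)) x w⟫ := by
  rw [real_inner_comm _ v, inner_fderiv_gradient, inner_fderiv_gradient]
  exact (hK.contDiffAt_supportFun hx).isSymmSndFDerivAt (by simpa using ENat.LEInfty.out) v w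

theorem fderiv_sphGrad_apply (hK : IsSmoothStrictlyConvexBody K) (hx : ‖x‖ = 1) {v : Euc n}
    (hv : ⟪x, v⟫ = 0) : fderiv ℝ (sphGrad (supportFun K)) x v =
      fderiv ℝ (gradient (supportFun K)) x v - supportFun K x • v -
        ⟪gradient (supportFun K) x, v⟫ • x := by
  have hx0 : x ≠ 0 := norm_ne_zero_iff.1 (hx ▸ one_ne_zero)
  have hsph : sphGrad (supportFun K) =ᶠ[𝓝 x] fun y =>
      ‖y‖⁻¹ • gradient (supportFun K) y - (‖y‖⁻¹ ^ 3 * supportFun K y) • y := by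
    filter_upwards [isOpen_ne.mem_nhds hx0] with y hy
    exact hK.sphGrad_supportFun hy
  have hder := ((hasFDerivAt_norm_inv hx0).smul (hK.differentiableAt_gradient hx0).hasFDerivAt).sub
    ((((hasFDerivAt_norm_inv hx0).pow 3).mul (hK.hasFDerivAt_supportFun hx0)).smul
      (hasFDerivAt_id x))
  rw [(hder.congr_of_eventuallyEq hsph).fderiv]
  simp [hx, hv]
  abel

theorem coe_sphHess_apply (hK : IsSmoothStrictlyConvexBody K) (hx : ‖x‖ = 1)
    (v : ((ℝ ∙ x)ᗮ : Submodule ℝ (Euc n))) :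
    (sphHess (supportFun K) x v : Euc n) =
      fderiv ℝ (gradient (supportFun K)) x v - supportFun K x • (v : Euc n) := by
  have hx0 : x ≠ 0 := norm_ne_zero_iff.1 (hx ▸ one_ne_zero)
  have hv : ⟪x, (v : Euc n)⟫ = 0 := Submodule.mem_orthogonal_singleton_iff_inner_right.1 v.2
  refine Submodule.eq_starProjection_of_mem_orthogonal (K := (ℝ ∙ x)ᗮ) ?_ ?_
  · rw [Submodule.mem_orthogonal_singleton_iff_inner_right, inner_sub_right,
      hK.inner_fderiv_gradient_eq_zero hx0, real_inner_smul_right, hv, mul_zero, sub_zero]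
  · change fderiv ℝ (sphGrad (supportFun K)) x v - _ ∈ _
    rw [hK.fderiv_sphGrad_apply hx hv, sub_sub_cancel_left]
    exact neg_mem (Submodule.smul_mem _ _
      (Submodule.le_orthogonal_orthogonal _ (Submodule.mem_span_singleton_self x)))

end Hessian

section ConeDensity

theorem fderiv_coneMap_apply (hK : IsSmoothStrictlyConvexBody K) (hx : ‖x‖ = 1) (v : Euc n) :
    fderiv ℝ (coneMap K) x v =
      fderiv ℝ (gradient (supportFun K)) x v + ⟪x, v⟫ • gradient (supportFun K) x := by
  have hx0 : x ≠ 0 := norm_ne_zero_iff.1 (hx ▸ one_ne_zero)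
  have hder : HasFDerivAt (coneMap K) _ x := (hasFDerivAt_norm_of_ne_zero hx0).smul
    (hK.differentiableAt_gradient hx0).hasFDerivAt
  rw [hder.fderiv]
  simp [hx]

theorem coneDensity_eq_mul_det (hK : IsSmoothStrictlyConvexBody K) (hx : ‖x‖ = 1) :
    coneDensity K x = supportFun K x *
      LinearMap.det (sphHess (supportFun K) x + supportFun K x •
        ContinuousLinearMap.id ℝ ((ℝ ∙ x)ᗮ : Submodule ℝ (Euc n)) :
          ((ℝ ∙ x)ᗮ : Submodule ℝ (Euc n)) →ₗ[ℝ] ((ℝ ∙ x)ᗮ : Submodule ℝ (Euc n))) := by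
  have hx0 : x ≠ 0 := norm_ne_zero_iff.1 (hx ▸ one_ne_zero)
  set W : Submodule ℝ (Euc n) := (ℝ ∙ x)ᗮ
  have hmem : ∀ v, v ∈ W ↔ ⟪x, v⟫ = 0 := fun v =>
    Submodule.mem_orthogonal_singleton_iff_inner_right
  let L : Euc n →ₗ[ℝ] Euc n := fderiv ℝ (coneMap K) x
  have hL : ∀ v, L v = fderiv ℝ (gradient (supportFun K)) x v +
      ⟪x, v⟫ • gradient (supportFun K) x := hK.fderiv_coneMap_apply hx
  have hinner : ∀ v, ⟪x, L v⟫ = supportFun K x * ⟪x, v⟫ := fun v => by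
    rw [hL, inner_add_right, hK.inner_fderiv_gradient_eq_zero hx0, real_inner_smul_right,
      hK.inner_gradient hx0, zero_add, mul_comm]
  have hinv : W ≤ W.comap L := fun v hv => by
    rw [Submodule.mem_comap, hmem, hinner, (hmem v).1 hv, mul_zero]
  have hrestrict : L.restrict hinv =
      (sphHess (supportFun K) x + supportFun K x • ContinuousLinearMap.id ℝ W : W →ₗ[ℝ] W) := by
    refine LinearMap.ext fun v => Subtype.ext ?_
    change L v = (sphHess (supportFun K) x v : Euc n) + supportFun K x • (v : Euc n)
    rw [hL, hK.coe_sphHess_apply hx, (hmem v).1 v.2, zero_smul, add_zero, sub_add_cancel]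
  have hquot : W.mapQ W L hinv = supportFun K x • LinearMap.id := by
    refine Submodule.linearMap_qext _ (LinearMap.ext fun v => ?_)
    refine (Submodule.Quotient.eq W).2 ?_
    rw [hmem, inner_sub_right, hinner]
    exact sub_eq_zero.2 (real_inner_smul_right _ _ _).symm
  have hrank : Module.finrank ℝ (Euc n ⧸ W) = 1 :=
    (W.quotientEquivOfIsCompl (ℝ ∙ x) (ℝ ∙ x).isCompl_orthogonal.symm).finrank_eq.trans
      (finrank_span_singleton hx0)
  change LinearMap.det L = _
  rw [LinearMap.det_eq_det_mul_det W L hinv, hquot, hrestrict, LinearMap.det_smul, hrank, pow_one,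
    LinearMap.det_id, mul_one, mul_comm]

theorem coneDensity_eq_div (hK : IsSmoothStrictlyConvexBody K) (hx : ‖x‖ = 1) :
    coneDensity K x = supportFun K x / gaussCurv K x := by
  rw [hK.coneDensity_eq_mul_det hx, gaussCurv, div_inv_eq_mul]

theorem isPositive_sphHess_add (hK : IsSmoothStrictlyConvexBody K) (hx : ‖x‖ = 1) :
    (sphHess (supportFun K) x + supportFun K x •
        ContinuousLinearMap.id ℝ ((ℝ ∙ x)ᗮ : Submodule ℝ (Euc n)) :
          ((ℝ ∙ x)ᗮ : Submodule ℝ (Euc n)) →ₗ[ℝ] ((ℝ ∙ x)ᗮ : Submodule ℝ (Euc n))).IsPositive := by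
  have hx0 : x ≠ 0 := norm_ne_zero_iff.1 (hx ▸ one_ne_zero)
  have happly : ∀ v : ((ℝ ∙ x)ᗮ : Submodule ℝ (Euc n)),
      (sphHess (supportFun K) x v : Euc n) + supportFun K x • (v : Euc n) =
        fderiv ℝ (gradient (supportFun K)) x v := fun v => by
    rw [hK.coe_sphHess_apply hx, sub_add_cancel]
  refine ⟨fun v w => ?_, fun v => ?_⟩
  · change ⟪(sphHess (supportFun K) x v : Euc n) + supportFun K x • (v : Euc n), (w : Euc n)⟫ =
      ⟪(v : Euc n), (sphHess (supportFun K) x w : Euc n) + supportFun K x • (w : Euc n)⟫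
    rw [happly, happly, hK.inner_fderiv_gradient_comm hx0]
  · change 0 ≤ ⟪(sphHess (supportFun K) x v : Euc n) + supportFun K x • (v : Euc n), (v : Euc n)⟫
    rw [happly]
    exact hK.inner_fderiv_gradient_self_nonneg hx0 v

theorem coneMap_smul (hK : IsSmoothStrictlyConvexBody K) {t : ℝ} (ht : 0 < t) (y : Euc n) :
    coneMap K (t • y) = t • coneMap K y := by
  rcases eq_or_ne y 0 with rfl | hy
  · simp [coneMap]
  · rw [coneMap, coneMap, hK.gradient_smul ht hy, norm_smul, Real.norm_of_nonneg ht.le, smul_smul]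

theorem coneDensity_smul (hK : IsSmoothStrictlyConvexBody K) {t : ℝ} (ht : 0 < t) (y : Euc n) :
    coneDensity K (t • y) = coneDensity K y := by
  have hderiv : t • fderiv ℝ (coneMap K) (t • y) = t • fderiv ℝ (coneMap K) y := by
    rw [← fderiv_comp_smul, funext fun z => hK.coneMap_smul ht z]
    exact congrFun (fderiv_const_smul_field (f := coneMap K) t) y
  exact congrArg ContinuousLinearMap.det (smul_right_injective _ ht.ne' hderiv)

theorem coneDensity_nonneg (hK : IsSmoothStrictlyConvexBody K) (h0 : (0 : Euc n) ∈ interior K)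
    (hy : y ≠ 0) : 0 ≤ coneDensity K y := by
  have hnorm : ‖‖y‖⁻¹ • y‖ = 1 := norm_smul_inv_norm hy
  rw [← hK.coneDensity_smul (inv_pos.2 (norm_pos_iff.2 hy)), hK.coneDensity_eq_mul_det hnorm]
  have hpos := hK.isPositive_sphHess_add hnorm
  have hunit : ‖y‖⁻¹ • y ≠ 0 := norm_ne_zero_iff.1 (hnorm ▸ one_ne_zero)
  refine mul_nonneg (supportFun_pos hK.isCompact h0 hunit).le ?_
  rw [hpos.isSymmetric.det_eq_prod_eigenvalues rfl]
  exact Finset.prod_nonneg fun i _ => hpos.nonneg_eigenvalues rfl i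

theorem contDiffAt_coneMap (hK : IsSmoothStrictlyConvexBody K) (hy : y ≠ 0) :
    ContDiffAt ℝ ∞ (coneMap K) y :=
  (contDiffAt_norm ℝ hy).smul (hK.contDiffAt_gradient hy)

theorem continuousAt_coneDensity (hK : IsSmoothStrictlyConvexBody K) (hy : y ≠ 0) :
    ContinuousAt (coneDensity K) y :=
  ContinuousLinearMap.continuous_det.continuousAt.comp (f := fderiv ℝ (coneMap K))
    ((hK.contDiffAt_coneMap hy).fderiv_right (m := ∞) (by simp)).continuousAt

end ConeDensity

end IsSmoothStrictlyConvexBody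

section Subgradient

variable {E : Type*} [NormedAddCommGroup E] [InnerProductSpace ℝ E] [CompleteSpace E]
  {f : E → ℝ} {g : E → E} {U : Set E} {z : E}

theorem hasGradientAt_of_continuousOn_subgradient (hU : IsOpen U) (hg : ContinuousOn g U)
    (hsub : ∀ z ∈ U, ∀ w, f z + ⟪g z, w - z⟫ ≤ f w) (hz : z ∈ U) : HasGradientAt f (g z) z := by
  have hsmall : (fun w => ‖g w - g z‖) =o[𝓝 z] fun _ => (1 : ℝ) := by
    rw [Asymptotics.isLittleO_one_iff, ← norm_zero (E := E), ← sub_self (g z)]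
    exact ((hg.continuousAt (hU.mem_nhds hz)).tendsto.sub_const (g z)).norm
  rw [hasGradientAt_iff_isLittleO]
  have hprod := hsmall.mul_isBigO (Asymptotics.isBigO_refl (fun w => w - z) (𝓝 z)).norm_norm
  simp only [one_mul] at hprod
  refine Asymptotics.IsBigO.trans_isLittleO (.of_bound 1 ?_) hprod.of_norm_right
  filter_upwards [hU.mem_nhds hz] with w hw
  have hlower := hsub z hz w
  have hupper := hsub w hw z
  have hcs := real_inner_le_norm (g w - g z) (w - z)
  rw [← neg_sub w z, inner_neg_right] at hupper
  rw [inner_sub_left] at hcs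
  rw [one_mul, norm_mul, norm_norm, norm_norm, Real.norm_of_nonneg (by linarith)]
  linarith

theorem contDiffAt_of_continuousOn_subgradient (hU : IsOpen U) (hg : ContinuousOn g U)
    (hsub : ∀ z ∈ U, ∀ w, f z + ⟪g z, w - z⟫ ≤ f w) (hz : z ∈ U) : ContDiffAt ℝ 1 f z :=
  contDiffAt_one_iff.2 ⟨fun w => InnerProductSpace.toDual ℝ E (g w), U, hU.mem_nhds hz,
    (InnerProductSpace.toDual ℝ E).continuous.comp_continuousOn hg, fun _ hw =>
      (hasGradientAt_of_continuousOn_subgradient hU hg hsub hw).hasFDerivAt⟩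

end Subgradient

section WithDensity

variable {α β : Type*} [MeasurableSpace α] [MeasurableSpace β] {μ : Measure α} {ν : Measure β}

theorem measurePreserving_withDensity_comp {f : α → β} (hf : MeasurePreserving f μ ν)
    {D : β → ENNReal} (hD : Measurable D) :
    MeasurePreserving f (μ.withDensity (D ∘ f)) (ν.withDensity D) := by
  refine ⟨hf.measurable, Measure.ext fun s hs => ?_⟩
  rw [Measure.map_apply hf.measurable hs, withDensity_apply _ (hf.measurable hs),
    withDensity_apply _ hs]
  exact hf.setLIntegral_comp_preimage hs hD

end WithDensity

namespace IsSmoothStrictlyConvexBody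

variable {n : ℕ} {K : Set (Euc n)} {x y z : Euc n}

section Gauge

theorem inner_coneMap (hK : IsSmoothStrictlyConvexBody K) (y : Euc n) :
    ⟪y, coneMap K y⟫ = ‖y‖ * supportFun K y := by
  rcases eq_or_ne y 0 with rfl | hy
  · simp
  · rw [coneMap, real_inner_smul_right, hK.inner_gradient hy]

theorem inner_coneMap_le (hK : IsSmoothStrictlyConvexBody K) (x y : Euc n) :
    ⟪x, coneMap K y⟫ ≤ supportFun K x * ‖y‖ := by
  rcases eq_or_ne y 0 with rfl | hy
  · simp [coneMap]
  · rw [coneMap, real_inner_smul_right, mul_comm]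
    exact mul_le_mul_of_nonneg_right
      (inner_le_supportFun hK.isCompact x (hK.gradient_mem hy)) (norm_nonneg y)

theorem gauge_gradient (hK : IsSmoothStrictlyConvexBody K) (h0 : (0 : Euc n) ∈ interior K)
    (hy : y ≠ 0) : gauge K (gradient (supportFun K) y) = 1 :=
  (gauge_eq_one_iff_mem_frontier hK.convex (mem_interior_iff_mem_nhds.1 h0)).2
    (hK.gradient_mem_frontier hy)

theorem gauge_coneMap (hK : IsSmoothStrictlyConvexBody K) (h0 : (0 : Euc n) ∈ interior K)
    (y : Euc n) : gauge K (coneMap K y) = ‖y‖ := by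
  rcases eq_or_ne y 0 with rfl | hy
  · simp [coneMap]
  · rw [coneMap, gauge_smul_of_nonneg (norm_nonneg y), hK.gauge_gradient h0 hy, smul_eq_mul,
      mul_one]

theorem coneMap_injective (hK : IsSmoothStrictlyConvexBody K) (h0 : (0 : Euc n) ∈ interior K) :
    Function.Injective (coneMap K) := by
  intro x y hxy
  have hnorm : ‖x‖ = ‖y‖ := by rw [← hK.gauge_coneMap h0 x, hxy, hK.gauge_coneMap h0 y]
  rcases eq_or_ne y 0 with rfl | hy
  · exact norm_eq_zero.1 (hnorm.trans norm_zero)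
  have hx : x ≠ 0 := norm_ne_zero_iff.1 (hnorm ▸ norm_ne_zero_iff.2 hy)
  rw [coneMap, coneMap, hnorm] at hxy
  obtain ⟨t, ht, rfl⟩ := hK.exists_pos_smul_eq_of_gradient_eq hx hy
    (smul_right_injective _ (norm_ne_zero_iff.2 hy) hxy)
  rw [norm_smul, Real.norm_of_nonneg ht.le, mul_eq_right₀ (norm_ne_zero_iff.2 hy)] at hnorm
  rw [hnorm, one_smul]

theorem coneMap_surjective (hK : IsSmoothStrictlyConvexBody K) (h0 : (0 : Euc n) ∈ interior K) :
    Function.Surjective (coneMap K) := by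
  intro z
  rcases eq_or_ne z 0 with rfl | hz
  · exact ⟨0, by simp [coneMap]⟩
  have hK0 := mem_interior_iff_mem_nhds.1 h0
  have hγ : 0 < gauge K z := (gauge_pos (absorbent_nhds_zero hK0)
    (NormedSpace.isVonNBounded_of_isBounded ℝ hK.isCompact.isBounded)).2 hz
  have hfrontier : (gauge K z)⁻¹ • z ∈ frontier K := by
    rw [← gauge_eq_one_iff_mem_frontier hK.convex hK0, gauge_smul_of_nonneg (inv_nonneg.2 hγ.le),
      smul_eq_mul, inv_mul_cancel₀ hγ.ne']
  obtain ⟨x, hx, hxz⟩ := hK.exists_gradient_eq hfrontier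
  have hnorm := norm_pos_iff.2 hx
  refine ⟨(gauge K z * ‖x‖⁻¹) • x, ?_⟩
  rw [hK.coneMap_smul (mul_pos hγ (inv_pos.2 hnorm)), coneMap, hxz, smul_smul, smul_smul,
    inv_mul_cancel_right₀ hnorm.ne', mul_inv_cancel₀ hγ.ne', one_smul]

theorem continuous_coneMap (hK : IsSmoothStrictlyConvexBody K) : Continuous (coneMap K) := by
  refine continuous_iff_continuousAt.2 fun y => ?_
  rcases eq_or_ne y 0 with rfl | hy
  · obtain ⟨C, hC⟩ := hK.isCompact.isBounded.exists_norm_le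
    have hbound : ∀ y, ‖coneMap K y‖ ≤ ‖y‖ * C := fun y => by
      rcases eq_or_ne y 0 with rfl | hy
      · simp [coneMap]
      · rw [coneMap, norm_smul, norm_norm]
        exact mul_le_mul_of_nonneg_left (hC _ (hK.gradient_mem hy)) (norm_nonneg y)
    have hlim : Tendsto (fun y : Euc n => ‖y‖ * C) (𝓝 0) (𝓝 0) := by
      simpa using (continuous_norm.mul_const C).tendsto (0 : Euc n)
    have hzero : coneMap K 0 = 0 := by simp [coneMap]
    rw [ContinuousAt, hzero]
    exact squeeze_zero_norm hbound hlim
  · exact (hK.contDiffAt_coneMap hy).continuousAt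

theorem tendsto_gauge_cocompact (hK : IsSmoothStrictlyConvexBody K)
    (h0 : (0 : Euc n) ∈ interior K) : Tendsto (gauge K) (cocompact (Euc n)) atTop := by
  obtain ⟨R, hR, hKR⟩ := hK.isCompact.isBounded.subset_closedBall_lt 0 0
  refine tendsto_atTop_mono (fun z => le_gauge_of_subset_closedBall
    (absorbent_nhds_zero (mem_interior_iff_mem_nhds.1 h0)) hR.le hKR) ?_
  exact tendsto_norm_cocompact_atTop.atTop_div_const hR

theorem isProperMap_coneMap (hK : IsSmoothStrictlyConvexBody K)
    (h0 : (0 : Euc n) ∈ interior K) : IsProperMap (coneMap K) := by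
  refine isProperMap_iff_isCompact_preimage.2 ⟨hK.continuous_coneMap, fun S hS => ?_⟩
  obtain ⟨C, hC⟩ := (hS.image
    (continuous_gauge hK.convex (mem_interior_iff_mem_nhds.1 h0))).bddAbove
  refine (isCompact_closedBall (0 : Euc n) C).of_isClosed_subset
    (hS.isClosed.preimage hK.continuous_coneMap) fun y hy => ?_
  rw [mem_closedBall_zero_iff, ← hK.gauge_coneMap h0]
  exact hC (Set.mem_image_of_mem _ hy)

theorem isHomeomorph_coneMap (hK : IsSmoothStrictlyConvexBody K)
    (h0 : (0 : Euc n) ∈ interior K) : IsHomeomorph (coneMap K) :=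
  isHomeomorph_iff_continuous_isClosedMap_bijective.2
    ⟨hK.continuous_coneMap, (hK.isProperMap_coneMap h0).isClosedMap,
      hK.coneMap_injective h0, hK.coneMap_surjective h0⟩

/-- The inverse of the homeomorphism `coneMap` supplies a continuous subgradient of the gauge, which
is therefore `C¹` off the origin: no smooth dependence of the gauge on the boundary is needed. -/
theorem exists_gauge_subgradient (hK : IsSmoothStrictlyConvexBody K)
    (h0 : (0 : Euc n) ∈ interior K) :
    ∃ g : Euc n → Euc n, ContinuousOn g {0}ᶜ ∧
      (∀ y, g (coneMap K y) = (supportFun K y)⁻¹ • y) ∧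
      ∀ z ∈ ({0}ᶜ : Set (Euc n)), ∀ w, gauge K z + ⟪g z, w - z⟫ ≤ gauge K w := by
  let Φ := (hK.isHomeomorph_coneMap h0).homeomorph (coneMap K)
  have hΦ : ∀ y, Φ.symm (coneMap K y) = y := Φ.symm_apply_apply
  have hΦ0 : ∀ z ≠ 0, Φ.symm z ≠ 0 := fun z hz h => hz <| by
    rw [← Φ.apply_symm_apply z, h]
    exact (show coneMap K 0 = 0 by simp [coneMap])
  refine ⟨fun z => (supportFun K (Φ.symm z))⁻¹ • Φ.symm z, fun z hz => ?_, fun y => ?_, ?_⟩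
  · have hh : ContinuousAt (fun z => supportFun K (Φ.symm z)) z :=
      (hK.contDiffAt_supportFun (hΦ0 z hz)).continuousAt.comp Φ.symm.continuous.continuousAt
    exact ((hh.inv₀ (supportFun_pos hK.isCompact h0 (hΦ0 z hz)).ne').smul
      Φ.symm.continuous.continuousAt).continuousWithinAt
  · simp only [hΦ]
  · intro z hz w
    obtain ⟨y, rfl⟩ := hK.coneMap_surjective h0 z
    obtain ⟨u, rfl⟩ := hK.coneMap_surjective h0 w
    have hy : y ≠ 0 := hΦ y ▸ hΦ0 _ hz
    have hpos := supportFun_pos hK.isCompact h0 hy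
    simp only [hΦ, hK.gauge_coneMap h0]
    rw [real_inner_smul_left, inner_sub_right, hK.inner_coneMap, mul_sub, mul_comm ‖y‖,
      inv_mul_cancel_left₀ hpos.ne', add_sub_cancel, inv_mul_le_iff₀ hpos]
    exact hK.inner_coneMap_le y u

theorem contDiffAt_gauge (hK : IsSmoothStrictlyConvexBody K) (h0 : (0 : Euc n) ∈ interior K)
    (hz : z ≠ 0) : ContDiffAt ℝ 1 (gauge K) z := by
  obtain ⟨g, hg, -, hsub⟩ := hK.exists_gauge_subgradient h0
  exact contDiffAt_of_continuousOn_subgradient isOpen_compl_singleton hg hsub hz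

theorem fderiv_gauge_gradient_apply (hK : IsSmoothStrictlyConvexBody K)
    (h0 : (0 : Euc n) ∈ interior K) (hx : x ≠ 0) (e : Euc n) :
    fderiv ℝ (gauge K) (gradient (supportFun K) x) e = ⟪x, e⟫ / supportFun K x := by
  obtain ⟨g, hg, hgx, hsub⟩ := hK.exists_gauge_subgradient h0
  have hnorm := norm_pos_iff.2 hx
  have hcone : coneMap K (‖x‖⁻¹ • x) = gradient (supportFun K) x := by
    rw [hK.coneMap_smul (inv_pos.2 hnorm), coneMap, inv_smul_smul₀ hnorm.ne']
  have hne : gradient (supportFun K) x ≠ 0 := fun h => by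
    have := hK.gauge_gradient h0 hx
    rw [h, gauge_zero] at this
    exact zero_ne_one this
  have hgrad := hasGradientAt_of_continuousOn_subgradient isOpen_compl_singleton hg hsub
    (Set.mem_compl_singleton_iff.2 hne)
  rw [hgrad.hasFDerivAt.fderiv, InnerProductSpace.toDual_apply_apply, ← hcone, hgx,
    supportFun_smul (inv_pos.2 hnorm).le, real_inner_smul_left, real_inner_smul_left,
    inv_mul_eq_div, mul_div_mul_left _ _ (inv_pos.2 hnorm).ne']

end Gauge

section ConeMeasure

theorem measurable_coneDensity (K : Set (Euc n)) : Measurable (coneDensity K) :=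
  ContinuousLinearMap.continuous_det.measurable.comp (measurable_fderiv ℝ (coneMap K))

theorem coneMeasure_eq_withDensity (hK : IsSmoothStrictlyConvexBody K) :
    coneMeasure K =
      (sphMeasure n).withDensity fun x => ENNReal.ofReal (coneDensity K (x : Euc n)) :=
  congrArg (sphMeasure n).withDensity <| funext fun x => by
    rw [hK.coneDensity_eq_div (norm_eq_of_mem_sphere x)]

theorem measurePreserving_coneMap (hK : IsSmoothStrictlyConvexBody K)
    (h0 : (0 : Euc n) ∈ interior K) :
    MeasurePreserving (coneMap K)
      (volume.withDensity fun y => ENNReal.ofReal (coneDensity K y)) volume := by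
  refine ⟨hK.continuous_coneMap.measurable, ?_⟩
  have hinj := hK.coneMap_injective h0
  have himage : coneMap K '' {0}ᶜ = {0}ᶜ := by
    rw [Set.image_compl_eq ⟨hinj, hK.coneMap_surjective h0⟩, Set.image_singleton]
    simp [coneMap]
  have hmap := map_withDensity_abs_det_fderiv_eq_addHaar (volume : Measure (Euc n))
    (measurableSet_singleton 0).compl.nullMeasurableSet
    (fun y hy => ((hK.contDiffAt_coneMap hy).differentiableAt
      (by simp)).hasFDerivAt.hasFDerivWithinAt) hinj.injOn
  rw [himage, restrict_compl_singleton] at hmap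
  refine Eq.trans (congrArg (Measure.map (coneMap K)) (withDensity_congr_ae ?_)) hmap
  filter_upwards [compl_mem_ae_iff.2 (measure_singleton (0 : Euc n))] with y hy
  exact congrArg ENNReal.ofReal (abs_of_nonneg (hK.coneDensity_nonneg h0 hy)).symm

theorem isFiniteMeasure_coneMeasure (hK : IsSmoothStrictlyConvexBody K) :
    IsFiniteMeasure (coneMeasure K) := by
  have hcont : Continuous fun x : Sph n => coneDensity K x :=
    continuous_comp_coe_sphere fun _ => hK.continuousAt_coneDensity
  rw [hK.coneMeasure_eq_withDensity]
  exact isFiniteMeasure_withDensity_ofReal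
    (hcont.integrable_of_hasCompactSupport (.of_compactSpace _)).2

theorem polarCoordinates_gauge (hK : IsSmoothStrictlyConvexBody K)
    (h0 : (0 : Euc n) ∈ interior K) :
    PolarCoordinates volume n (coneMeasure K) (fun x : Sph n => gradient (supportFun K) x)
      (gauge K) where
  continuous := continuous_gauge hK.convex (mem_interior_iff_mem_nhds.1 h0)
  contDiffAt _ := hK.contDiffAt_gauge h0
  map_smul t ht z := by rw [gauge_smul_of_nonneg ht.le, smul_eq_mul]
  tendsto_cocompact := hK.tendsto_gauge_cocompact h0
  apply_eq_one x := hK.gauge_gradient h0 (ne_zero_of_mem_unit_sphere x)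
  measurePreserving := by
    have hD : Measurable fun y => ENNReal.ofReal (coneDensity K y) :=
      (measurable_coneDensity K).ennreal_ofReal
    convert (hK.measurePreserving_coneMap h0).comp (measurePreserving_withDensity_comp
      (polarCoordinates_sphMeasure n).measurePreserving hD) using 1
    · funext ⟨x, r, hr⟩
      simp only [Function.comp_apply]
      rw [hK.coneMap_smul hr, coneMap, norm_eq_of_mem_sphere, one_smul]
    · rw [hK.coneMeasure_eq_withDensity, prod_withDensity_left
        (f := fun x : Sph n => ENNReal.ofReal (coneDensity K x)) (hD.comp measurable_subtype_coe)]
      exact congrArg _ (funext fun z => congrArg ENNReal.ofReal (hK.coneDensity_smul z.2.2 _).symm)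

end ConeMeasure

end IsSmoothStrictlyConvexBody

theorem norm_sub_inner_smul_sq {E : Type*} [NormedAddCommGroup E] [InnerProductSpace ℝ E] {x : E}
    (hx : ‖x‖ = 1) (a : E) : ‖a - ⟪x, a⟫ • x‖ ^ 2 = ‖a‖ ^ 2 - ⟪x, a⟫ ^ 2 := by
  rw [norm_sub_sq_real, real_inner_smul_right, real_inner_comm, norm_smul, hx, mul_one,
    Real.norm_eq_abs, sq_abs]
  ring

namespace IsSmoothStrictlyConvexBody

variable {n : ℕ} {K : Set (Euc n)} {x : Euc n}

section Translate

theorem supportFun_image_sub (hK : IsSmoothStrictlyConvexBody K) (c y : Euc n) :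
    supportFun ((fun z => z - c) '' K) y = supportFun K y - ⟪y, c⟫ := by
  obtain ⟨q, hq, hqy⟩ := exists_supportFun_eq_inner hK.isCompact hK.nonempty y
  rw [hqy, ← inner_sub_right]
  refine supportFun_eq_of_forall_inner_le ⟨q, hq, rfl⟩ (Set.forall_mem_image.2 fun k hk => ?_)
  rw [inner_sub_right, inner_sub_right, ← hqy]
  exact sub_le_sub_right (inner_le_supportFun hK.isCompact y hk) _

theorem sphGrad_supportFun_image_sub (hK : IsSmoothStrictlyConvexBody K) (c : Euc n)
    (hx : ‖x‖ = 1) :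
    sphGrad (supportFun ((fun z => z - c) '' K)) x =
      (gradient (supportFun K) x - c) - ⟪x, gradient (supportFun K) x - c⟫ • x := by
  have hx0 : x ≠ 0 := norm_ne_zero_iff.1 (hx ▸ one_ne_zero)
  have hext : radialExt (supportFun ((fun z => z - c) '' K)) = fun z =>
      ‖z‖⁻¹ * (supportFun K z - innerSL ℝ c z) := funext fun z => by
    rw [radialExt, hK.supportFun_image_sub, supportFun_smul (inv_nonneg.2 (norm_nonneg z)),
      real_inner_smul_left, innerSL_apply_apply, real_inner_comm, mul_sub]
  rw [sphGrad, hext]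
  refine HasGradientAt.gradient (((hasFDerivAt_norm_inv hx0).mul ((hK.hasFDerivAt_supportFun
    hx0).sub (innerSL ℝ c).hasFDerivAt)).congr_fderiv (ContinuousLinearMap.ext fun v => ?_))
  simp [hx, inner_sub_right, hK.inner_gradient hx0, real_inner_comm x c]
  ring

theorem sphGrad_supportFun_of_norm_eq_one (hK : IsSmoothStrictlyConvexBody K) (hx : ‖x‖ = 1) :
    sphGrad (supportFun K) x =
      gradient (supportFun K) x - ⟪x, gradient (supportFun K) x⟫ • x := by
  have hx0 : x ≠ 0 := norm_ne_zero_iff.1 (hx ▸ one_ne_zero)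
  rw [hK.sphGrad_supportFun hx0, hK.inner_gradient hx0, hx, inv_one, one_smul, one_pow, one_mul]

theorem norm_sphGrad_supportFun_sq (hK : IsSmoothStrictlyConvexBody K) (c : Euc n)
    (hx : ‖x‖ = 1) :
    ‖sphGrad (supportFun K) x‖ ^ 2 =
      ‖sphGrad (supportFun ((fun z => z - c) '' K)) x‖ ^ 2 +
        (2 * ⟪gradient (supportFun K) x, c⟫ - ‖c‖ ^ 2 +
          (⟪x, c⟫ * ⟪x, c⟫ - 2 * (supportFun K x * ⟪x, c⟫))) := by
  have hx0 : x ≠ 0 := norm_ne_zero_iff.1 (hx ▸ one_ne_zero)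
  rw [hK.sphGrad_supportFun_image_sub c hx, hK.sphGrad_supportFun_of_norm_eq_one hx,
    norm_sub_inner_smul_sq hx, norm_sub_inner_smul_sq hx, norm_sub_sq_real, inner_sub_right,
    hK.inner_gradient hx0]
  ring

theorem continuous_supportFun_coe (hK : IsSmoothStrictlyConvexBody K) :
    Continuous fun x : Sph n => supportFun K x :=
  continuous_comp_coe_sphere fun _ hy => (hK.contDiffAt_supportFun hy).continuousAt

theorem continuous_gradient_supportFun_coe (hK : IsSmoothStrictlyConvexBody K) :
    Continuous fun x : Sph n => gradient (supportFun K) x :=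
  continuous_comp_coe_sphere fun _ hy => (hK.contDiffAt_gradient hy).continuousAt

theorem integral_norm_sphGrad_supportFun_sq (hK : IsSmoothStrictlyConvexBody K)
    (ν : Measure (Sph n)) [IsFiniteMeasure ν] (c : Euc n) :
    ∫ x : Sph n, ‖sphGrad (supportFun K) x‖ ^ 2 ∂ν =
      ∫ x : Sph n, ‖sphGrad (supportFun ((fun z => z - c) '' K)) x‖ ^ 2 ∂ν +
        (2 * ∫ x : Sph n, ⟪gradient (supportFun K) x, c⟫ ∂ν - ‖c‖ ^ 2 * ν.real Set.univ +
          (∫ x : Sph n, ⟪(x : Euc n), c⟫ * ⟪(x : Euc n), c⟫ ∂ν -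
            2 * ∫ x : Sph n, supportFun K x * ⟪(x : Euc n), c⟫ ∂ν)) := by
  have hint {f : Sph n → ℝ} (hf : Continuous f) : Integrable f ν :=
    hf.integrable_of_hasCompactSupport (.of_compactSpace f)
  have hh := hK.continuous_supportFun_coe
  have hX := hK.continuous_gradient_supportFun_coe
  have htranslate : Continuous fun x : Sph n =>
      ‖sphGrad (supportFun ((fun z => z - c) '' K)) x‖ ^ 2 := by
    simp only [fun x : Sph n => hK.sphGrad_supportFun_image_sub c (norm_eq_of_mem_sphere x)]
    fun_prop
  simp only [fun x : Sph n => hK.norm_sphGrad_supportFun_sq c (norm_eq_of_mem_sphere x)]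
  rw [integral_add (hint htranslate) (hint (by fun_prop)),
    integral_add (hint (by fun_prop)) (hint (by fun_prop)),
    integral_sub (hint (by fun_prop)) (hint (by fun_prop)),
    integral_sub (hint (by fun_prop)) (hint (by fun_prop)),
    integral_const_mul, integral_const_mul, integral_const, smul_eq_mul, mul_comm (ν.real _)]

end Translate

section Centroid

theorem coneMeasure_ne_zero (hK : IsSmoothStrictlyConvexBody K)
    (h0 : (0 : Euc n) ∈ interior K) : coneMeasure K ≠ 0 := fun h => by
  have hmap := (hK.polarCoordinates_gauge h0).measurePreserving.map_eq
  rw [h, Measure.zero_prod, Measure.map_zero] at hmap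
  exact NeZero.ne (volume : Measure (Euc n)) hmap.symm

theorem integral_inner_gradient_coneCenter (hK : IsSmoothStrictlyConvexBody K)
    (h0 : (0 : Euc n) ∈ interior K) (e : Euc n) :
    ∫ x : Sph n, ⟪gradient (supportFun K) x, e⟫ ∂(coneMeasure K) =
      ⟪coneCenter K, e⟫ * (coneMeasure K).real Set.univ := by
  have := hK.isFiniteMeasure_coneMeasure
  have hmass : (coneMeasure K).real Set.univ ≠ 0 := by
    rw [measureReal_ne_zero_iff, Measure.measure_univ_ne_zero]
    exact hK.coneMeasure_ne_zero h0
  have hcenter : (coneMeasure K).real Set.univ • coneCenter K =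
      ∫ x : Sph n, gradient (supportFun K) x ∂(coneMeasure K) := by
    simp only [coneCenter, integral_const, smul_eq_mul, mul_one, smul_inv_smul₀ hmass,
      fun x : Sph n => hK.invGaussMap_eq_gradient (norm_eq_of_mem_sphere x)]
  have hinner := integral_inner (𝕜 := ℝ) (hK.continuous_gradient_supportFun_coe
    |>.integrable_of_hasCompactSupport (μ := coneMeasure K) (.of_compactSpace _)) e
  simp only [real_inner_comm _ e] at hinner
  rw [hinner, ← hcenter, real_inner_smul_left, mul_comm]

theorem integral_inner_gradient_mul_inner_div (hK : IsSmoothStrictlyConvexBody K)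
    (h0 : (0 : Euc n) ∈ interior K) (a b : Euc n) :
    (n + 1) * ∫ x : Sph n, ⟪gradient (supportFun K) x, a⟫ * (⟪(x : Euc n), b⟫ / supportFun K x)
        ∂(coneMeasure K) = ⟪a, b⟫ * (coneMeasure K).real Set.univ := by
  have := hK.isFiniteMeasure_coneMeasure
  have hdiv := (hK.polarCoordinates_gauge h0).integral_fderiv_eq (F := innerSL ℝ a) (d := 1)
    (fun z _ => (innerSL ℝ a).contDiff.contDiffAt)
    (.of_map_smul fun t _ y => (innerSL ℝ a).map_smul t y) b
  simp only [ContinuousLinearMap.fderiv, innerSL_apply_apply, integral_const, smul_eq_mul,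
    fun x : Sph n => hK.fderiv_gauge_gradient_apply h0 (ne_zero_of_mem_unit_sphere x)] at hdiv
  simp only [real_inner_comm a]
  rw [← hdiv, mul_comm]

end Centroid

section PowerDensity

variable {p : ℝ}

theorem integral_coneMeasure_of_rpow (hK : IsSmoothStrictlyConvexBody K)
    (h0 : (0 : Euc n) ∈ interior K)
    (hV : coneMeasure K = (sphMeasure n).withDensity fun x =>
      ENNReal.ofReal (supportFun K (x : Euc n) ^ p)) (g : Sph n → ℝ) :
    ∫ x, g x ∂(coneMeasure K) = ∫ x, supportFun K (x : Euc n) ^ p * g x ∂(sphMeasure n) := by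
  have hpos : ∀ x : Sph n, 0 < supportFun K (x : Euc n) := fun x =>
    supportFun_pos hK.isCompact h0 (ne_zero_of_mem_unit_sphere x)
  have hcont : Continuous fun x : Sph n => supportFun K (x : Euc n) ^ p :=
    hK.continuous_supportFun_coe.rpow_const fun x => .inl (hpos x).ne'
  rw [hV, integral_withDensity_eq_integral_toReal_smul hcont.measurable.ennreal_ofReal
    (Eventually.of_forall fun _ => ENNReal.ofReal_lt_top)]
  simp only [ENNReal.toReal_ofReal (Real.rpow_nonneg (hpos _).le p), smul_eq_mul]

theorem hasFDerivAt_supportFun_rpow (hK : IsSmoothStrictlyConvexBody K)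
    (h0 : (0 : Euc n) ∈ interior K) (s : ℝ) (hx : x ≠ 0) :
    HasFDerivAt (fun z => supportFun K z ^ s)
      ((s * supportFun K x ^ (s - 1)) • innerSL ℝ (gradient (supportFun K) x)) x :=
  (hK.hasFDerivAt_supportFun hx).rpow_const (.inl (supportFun_pos hK.isCompact h0 hx).ne')

theorem contDiffAt_supportFun_rpow (hK : IsSmoothStrictlyConvexBody K)
    (h0 : (0 : Euc n) ∈ interior K) (s : ℝ) (hx : x ≠ 0) :
    ContDiffAt ℝ 1 (fun z => supportFun K z ^ s) x :=
  ((hK.contDiffAt_supportFun hx).of_le (by simp)).rpow_const_of_ne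
    (supportFun_pos hK.isCompact h0 hx).ne'

theorem isPosHomogeneous_supportFun_rpow (hK : IsSmoothStrictlyConvexBody K)
    (h0 : (0 : Euc n) ∈ interior K) (s : ℝ) :
    IsPosHomogeneous (fun z => supportFun K z ^ s) s := by
  have hhom : IsPosHomogeneous (supportFun K) 1 := .of_map_smul fun t ht => supportFun_smul ht.le
  simpa only [one_mul] using hhom.rpow (fun y hy => (supportFun_pos hK.isCompact h0 hy).le) s

theorem integral_inner_gradient_of_rpow (hK : IsSmoothStrictlyConvexBody K)
    (h0 : (0 : Euc n) ∈ interior K)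
    (hV : coneMeasure K = (sphMeasure n).withDensity fun x =>
      ENNReal.ofReal (supportFun K (x : Euc n) ^ p)) (e : Euc n) :
    (p + 1) * ∫ x : Sph n, ⟪gradient (supportFun K) x, e⟫ ∂(coneMeasure K) =
      (n + 1 + p) * ∫ x : Sph n, supportFun K x * ⟪(x : Euc n), e⟫ ∂(coneMeasure K) := by
  have hdiv := integral_fderiv_sphMeasure (fun _ => hK.contDiffAt_supportFun_rpow h0 (p + 1))
    (hK.isPosHomogeneous_supportFun_rpow h0 (p + 1)) e
  have hfderiv : ∀ x : Sph n, fderiv ℝ (fun z => supportFun K z ^ (p + 1)) x e =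
      (p + 1) * (supportFun K (x : Euc n) ^ p * ⟪gradient (supportFun K) x, e⟫) := fun x => by
    rw [(hK.hasFDerivAt_supportFun_rpow h0 (p + 1) (ne_zero_of_mem_unit_sphere x)).fderiv]
    simp [mul_assoc]
  have hpow : ∀ x : Sph n, supportFun K (x : Euc n) ^ (p + 1) =
      supportFun K (x : Euc n) ^ p * supportFun K x := fun x =>
    Real.rpow_add_one (supportFun_pos hK.isCompact h0 (ne_zero_of_mem_unit_sphere x)).ne' p
  simp only [hfderiv, hpow, mul_assoc, integral_const_mul] at hdiv
  rw [hK.integral_coneMeasure_of_rpow h0 hV, hK.integral_coneMeasure_of_rpow h0 hV, hdiv]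
  ring

theorem fderiv_supportFun_rpow_mul_inner_apply (hK : IsSmoothStrictlyConvexBody K)
    (h0 : (0 : Euc n) ∈ interior K) (s : ℝ) (hx : x ≠ 0) (a b : Euc n) :
    fderiv ℝ (fun z => supportFun K z ^ s * innerSL ℝ a z) x b =
      supportFun K x ^ s *
        (s * (⟪gradient (supportFun K) x, b⟫ * (⟪x, a⟫ / supportFun K x)) + ⟪a, b⟫) := by
  have hder : HasFDerivAt (fun z => supportFun K z ^ s * innerSL ℝ a z) _ x :=
    (hK.hasFDerivAt_supportFun_rpow h0 s hx).mul (innerSL ℝ a).hasFDerivAt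
  rw [hder.fderiv, Real.rpow_sub_one (supportFun_pos hK.isCompact h0 hx).ne']
  simp [real_inner_comm x a]
  ring

theorem integral_inner_mul_inner_of_rpow (hK : IsSmoothStrictlyConvexBody K)
    (h0 : (0 : Euc n) ∈ interior K)
    (hV : coneMeasure K = (sphMeasure n).withDensity fun x =>
      ENNReal.ofReal (supportFun K (x : Euc n) ^ p)) (a b : Euc n) :
    p * ∫ x : Sph n, ⟪gradient (supportFun K) x, b⟫ * (⟪(x : Euc n), a⟫ / supportFun K x)
          ∂(coneMeasure K) + ⟪a, b⟫ * (coneMeasure K).real Set.univ =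
      (n + 1 + p) * ∫ x : Sph n, ⟪(x : Euc n), a⟫ * ⟪(x : Euc n), b⟫ ∂(coneMeasure K) := by
  have := hK.isFiniteMeasure_coneMeasure
  have hlin : IsPosHomogeneous (innerSL ℝ a) 1 :=
    .of_map_smul fun t _ y => (innerSL ℝ a).map_smul t y
  have hdiv := integral_fderiv_sphMeasure (F := fun z => supportFun K z ^ p * innerSL ℝ a z)
    (fun _ hz => (hK.contDiffAt_supportFun_rpow h0 p hz).mul (innerSL ℝ a).contDiff.contDiffAt)
    ((hK.isPosHomogeneous_supportFun_rpow h0 p).mul hlin) b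
  have hcont : Continuous fun x : Sph n =>
      ⟪gradient (supportFun K) x, b⟫ * (⟪(x : Euc n), a⟫ / supportFun K x) :=
    (hK.continuous_gradient_supportFun_coe.inner continuous_const).mul
      ((continuous_subtype_val.inner continuous_const).div hK.continuous_supportFun_coe
        fun x => (supportFun_pos hK.isCompact h0 (ne_zero_of_mem_unit_sphere x)).ne')
  simp only [fun x : Sph n => hK.fderiv_supportFun_rpow_mul_inner_apply h0 p
    (ne_zero_of_mem_unit_sphere x)] at hdiv
  simp only [innerSL_apply_apply, real_inner_comm _ a, mul_assoc] at hdiv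
  rw [← hK.integral_coneMeasure_of_rpow h0 hV, ← hK.integral_coneMeasure_of_rpow h0 hV,
    integral_add ((hcont.const_mul p).integrable_of_hasCompactSupport (.of_compactSpace _))
      (integrable_const _), integral_const_mul, integral_const, smul_eq_mul] at hdiv
  rw [real_inner_comm b a]
  linear_combination hdiv

theorem integral_inner_mul_inner_isotropic (hK : IsSmoothStrictlyConvexBody K)
    (h0 : (0 : Euc n) ∈ interior K) (hp : (n : ℝ) + 1 + p ≠ 0)
    (hV : coneMeasure K = (sphMeasure n).withDensity fun x =>
      ENNReal.ofReal (supportFun K (x : Euc n) ^ p)) (a b : Euc n) :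
    (n + 1) * ∫ x : Sph n, ⟪(x : Euc n), a⟫ * ⟪(x : Euc n), b⟫ ∂(coneMeasure K) =
      ⟪a, b⟫ * (coneMeasure K).real Set.univ := by
  have hbody := hK.integral_inner_gradient_mul_inner_div h0 b a
  have hsphere := hK.integral_inner_mul_inner_of_rpow h0 hV a b
  rw [real_inner_comm] at hbody
  rw [← mul_right_inj' hp]
  linear_combination p * hbody - (n + 1) * hsphere

end PowerDensity

end IsSmoothStrictlyConvexBody

theorem mainTheorem6_general (n : ℕ) (K : Set (Euc n))
    (hK : IsSmoothStrictlyConvexBody K) (h0 : (0 : Euc n) ∈ interior K)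
    (p : ℝ) (hp : (n : ℝ) + 1 + p ≠ 0)
    (hV : coneMeasure K =
      (sphMeasure n).withDensity
        (fun x => ENNReal.ofReal (supportFun K (x : Euc n) ^ p))) :
    ∫ x : Sph n, ‖sphGrad (supportFun K) (x : Euc n)‖ ^ 2 ∂(coneMeasure K) =
      ∫ x : Sph n, ‖sphGrad (supportFun (centeredBody K)) (x : Euc n)‖ ^ 2 ∂(coneMeasure K) +
        (n : ℝ) * ((n : ℝ) + 1 - p) * ‖coneCenter K‖ ^ 2 / (((n : ℝ) + 1) * ((n : ℝ) + 1 + p)) *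
          ∫ _x : Sph n, (1 : ℝ) ∂(coneMeasure K) := by
  have := hK.isFiniteMeasure_coneMeasure
  set c := coneCenter K with hc
  have hexpand := hK.integral_norm_sphGrad_supportFun_sq (coneMeasure K) c
  set W := ‖c‖ ^ 2 * (coneMeasure K).real Set.univ with hW
  have hn : (n : ℝ) + 1 ≠ 0 := by positivity
  have hcenter : ∫ x : Sph n, ⟪gradient (supportFun K) x, c⟫ ∂(coneMeasure K) = W := by
    rw [hK.integral_inner_gradient_coneCenter h0, ← hc, real_inner_self_eq_norm_sq]
  have hsupport : ∫ x : Sph n, supportFun K x * ⟪(x : Euc n), c⟫ ∂(coneMeasure K) =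
      (p + 1) * W / (n + 1 + p) := by
    rw [eq_div_iff hp, ← hcenter, hK.integral_inner_gradient_of_rpow h0 hV, mul_comm]
  have hisotropic : ∫ x : Sph n, ⟪(x : Euc n), c⟫ * ⟪(x : Euc n), c⟫ ∂(coneMeasure K) =
      W / (n + 1) := by
    rw [eq_div_iff hn, mul_comm, hK.integral_inner_mul_inner_isotropic h0 hp hV,
      real_inner_self_eq_norm_sq]
  rw [hexpand, hcenter, hsupport, hisotropic, integral_const, smul_eq_mul, mul_one,
    centeredBody, ← hc, hW]
  field_simp
  ring

theorem mainTheorem6 (n : ℕ) (hn : 1 ≤ n) (K : Set (Euc n))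
    (hK : IsSmoothStrictlyConvexBody K) (h0 : (0 : Euc n) ∈ interior K)
    (p : ℝ) (hp : -(n : ℝ) - 1 < p)
    (hV : coneMeasure K =
      (sphMeasure n).withDensity
        (fun x => ENNReal.ofReal (supportFun K (x : Euc n) ^ p))) :
    ∫ x : Sph n, ‖sphGrad (supportFun K) (x : Euc n)‖ ^ 2 ∂(coneMeasure K) =
      ∫ x : Sph n, ‖sphGrad (supportFun (centeredBody K)) (x : Euc n)‖ ^ 2 ∂(coneMeasure K) +
        (n : ℝ) * ((n : ℝ) + 1 - p) * ‖coneCenter K‖ ^ 2 / (((n : ℝ) + 1) * ((n : ℝ) + 1 + p)) *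
          ∫ _x : Sph n, (1 : ℝ) ∂(coneMeasure K) :=
  mainTheorem6_general n K hK h0 p (by linarith) hV
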